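/- For an entire function $f$ put $f^*(z)=\overline{f(\overline z)}$. Let $\mathcal{HB}$ be the set of entire functions $E$ with $|E(\overline z)|<|E(z)|$ whenever $\operatorname{Im} z>0$. For $E\in\mathcal{HB}$ the de Branges space $\mathcal H(E)$ consists of all entire functions $f$ with $\|f\|_E^2=\int_{\mathbb R}|f(t)/E(t)|^2\,dt<\infty$ such that $f/E$ and $f^*/E$ are of bounded type (quotients of two bounded analytic functions) and of nonpositive mean type ($\limsup_{y\to+\infty} y^{-1}\log|\cdot(iy)|\le 0$) in the upper half-plane. Let $$K_E(w,z)=\frac{\overline{E(w)}E(z)-E(\overline w)E^*(z)}{2\pi i(\overline w-z)},$$ extended by continuity to $z=\overline w$. A phase function of $E$ is a continuous, strictly increasing $\varphi:\mathbb R\to\mathbb R$ such that $E(x)e^{i\varphi(x)}\in\mathbb R$ for all $x\in\mathbb R$. Let $E,F\in\mathcal{HB}$, let $\varphi_{EF}$ be a phase function of $EF$, let $\alpha\in[0,\pi)$, and let $\{\lambda_n\}_{n\in I}\subset\mathbb R$, where $I\subseteq\mathbb Z$ (for instance $I=\mathbb Z$), satisfy $\varphi_{EF}(\lambda_n)=n\pi+\alpha$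 for all $n\in I$. Suppose that $\{K_{EF}(\lambda_n,\cdot)\}_{n\in I}$ is complete in $\mathcal H(EF)$, i.e. that its finite linear combinations approximate every element of $\mathcal H(EF)$ in norm. Then for all $f\in\mathcal H(E)$ and $g\in\mathcal H(F)$ and every $z\in\mathbb C$, $$f(z)=\sum_{n\in I}\bigl(f(\lambda_n)F(\lambda_n)+g(\lambda_n)E^*(\lambda_n)\bigr)\frac{\overline{F(\lambda_n)}\,K_E(\lambda_n,z)}{K_{EF}(\lambda_n,\lambda_n)},$$ $$g(z)=\sum_{n\in I}\bigl(f(\lambda_n)F(\lambda_n)+g(\lambda_n)E^*(\lambda_n)\bigr)\frac{E(\lambda_n)\,K_F(\lambda_n,z)}{K_{EF}(\lambda_n,\lambda_n)}.$$ Both series converge unconditionally, pointwise on $\mathbb C$ and in the norm of $\mathcal H(E)$, respectively $\mathcal H(F)$. -/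

import Mathlib

open Filter Topology MeasureTheory
open scoped ComplexConjugate ENNReal

noncomputable section

/-- The entire function `f*(z) = conj (f (conj z))`. -/
def entireStar (f : ℂ → ℂ) : ℂ → ℂ := fun z => conj (f (conj z))

/-- The Hermite-Biehler class: entire functions with `|E(conj z)| < |E(z)|` in the open upper
half-plane. Real zeros are allowed. -/
structure IsHermiteBiehler (E : ℂ → ℂ) : Prop where
  entire : Differentiable ℂ E
  norm_conj_lt : ∀ z : ℂ, 0 < z.im → ‖E (conj z)‖ < ‖E z‖

/-- `f` is analytic and of bounded type in the open upper half-plane: it is a quotient `P / Q` of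
two bounded analytic functions there, where `Q` is not identically zero. -/
def IsBoundedType (f : ℂ → ℂ) : Prop :=
  DifferentiableOn ℂ f {z : ℂ | 0 < z.im} ∧
  ∃ P Q : ℂ → ℂ,
    DifferentiableOn ℂ P {z : ℂ | 0 < z.im} ∧ DifferentiableOn ℂ Q {z : ℂ | 0 < z.im} ∧
    (∃ M : ℝ, ∀ z : ℂ, 0 < z.im → ‖P z‖ ≤ M ∧ ‖Q z‖ ≤ M) ∧
    (∃ z : ℂ, 0 < z.im ∧ Q z ≠ 0) ∧
    ∀ z : ℂ, 0 < z.im → f z * Q z = P z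

/-- The mean type `limsup_{y → +∞} log |f(iy)| / y`, an extended real number; here
`log 0 = -∞`, so that the zero function has mean type `-∞`. -/
def meanType (f : ℂ → ℂ) : EReal :=
  limsup (fun y : ℝ => ENNReal.log ‖f (y * Complex.I)‖ₑ / (y : EReal)) atTop

/-- The squared norm `‖f‖_E ^ 2 = ∫ |f(t) / E(t)| ^ 2 dt` (over the real line), in `[0, ∞]`. -/
def deBrangesNormSq (E f : ℂ → ℂ) : ℝ≥0∞ :=
  ∫⁻ t : ℝ, ‖f t / E t‖ₑ ^ 2

/-- The de Branges space `H(E)`: all entire functions `f` of finite norm such that `f / E` and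
`f* / E` are of bounded type and nonpositive mean type in the upper half-plane. -/
def deBrangesSpace (E : ℂ → ℂ) : Set (ℂ → ℂ) :=
  {f | Differentiable ℂ f ∧ deBrangesNormSq E f < ∞ ∧
    (IsBoundedType (fun z => f z / E z) ∧ meanType (fun z => f z / E z) ≤ 0) ∧
    (IsBoundedType (fun z => entireStar f z / E z) ∧
      meanType (fun z => entireStar f z / E z) ≤ 0)}

/-- The numerator `conj (E w) E(z) - E(conj w) E*(z)` of the reproducing kernel. -/
def kernelNumerator (E : ℂ → ℂ) (w z : ℂ) : ℂ :=
  conj (E w) * E z - E (conj w) * entireStar E z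

/-- The reproducing kernel
`K_E(w, z) = (conj (E w) E(z) - E(conj w) E*(z)) / (2 π i (conj w - z))`.
At `z = conj w`, where the numerator vanishes, it is extended by continuity. -/
def deBrangesKernel (E : ℂ → ℂ) (w z : ℂ) : ℂ :=
  if z = conj w then
    -deriv (kernelNumerator E w) (conj w) / (2 * Real.pi * Complex.I)
  else
    kernelNumerator E w z / (2 * Real.pi * Complex.I * (conj w - z))

/-- `φ` is a phase function of `E`: continuous, strictly increasing, and `E(x) e^{i φ(x)}` is real
for every real `x`. -/
structure IsPhaseFunction (E : ℂ → ℂ) (φ : ℝ → ℝ) : Prop where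
  continuous : Continuous φ
  strictMono : StrictMono φ
  real : ∀ x : ℝ, (E x * Complex.exp (Complex.I * φ x)).im = 0

/-- The family `k` is complete in `H(E)`: every element of `H(E)` can be approximated in the norm
of `H(E)` by finite linear combinations of members of `k`. -/
def IsCompleteIn {ι : Type*} (E : ℂ → ℂ) (k : ι → ℂ → ℂ) : Prop :=
  ∀ h ∈ deBrangesSpace E, ∀ ε : ℝ≥0∞, 0 < ε →
    ∃ p ∈ Submodule.span ℂ (Set.range k), deBrangesNormSq E (h - p) < ε

/-- The multiplexed sample of `f` and `g` at the point `x`: `f(x) F(x) + g(x) E*(x)`. -/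
def multiplexedSample (E F f g : ℂ → ℂ) (x : ℂ) : ℂ :=
  f x * F x + g x * entireStar E x

end

open Filter Topology MeasureTheory
open scoped ComplexConjugate ENNReal

noncomputable section

/-! The map (f, g) ↦ fF + gE* is an isometry of H(E) ⊕ H(F) into H(EF). Divided by EF it reads f/E +
(E*/E)(g/F). On the real line E*/E has modulus one, so both summands keep their norms. Their inner
product is the integral of (f*/E)(g/F), a product of two Hardy functions of the upper half-plane,
hence zero (`IsHermiteBiehler.norm_multiplex_sq`). The same map sends the pair (conj F(l) · K_E(l,
·), E(l) · K_F(l, ·)) to K_EF(l, ·) for real l (`deBrangesKernel_mul`).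

Because the phases agree modulo π, the functions K_EF(λ_n, ·) are pairwise orthogonal
(`deBrangesKernel_eq_zero_of_phase`). By the reproducing property the orthogonal expansion of fF +
gE* has the coefficients (value at λ_n) / K_EF(λ_n, λ_n), and completeness makes it converge
(`tendsto_sub_sum_of_orthogonal`). Each remainder of this expansion is the image of the pair of
remainders of the two series in question. The isometry therefore gives norm convergence in both
components, and boundedness of point evaluations (`IsHermiteBiehler.exists_norm_le`) gives pointwise
convergence.

Most of the work is to show that f/E belongs to a Hardy class (`IsHermiteBiehler.exists_isHardy`).
Local integrability excludes poles at real zeros of E. For a function u of bounded type, the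
Poisson-Jensen inequality on discs, carried to the half-plane by the Cayley transform, bounds |u|²
by exp(C Im z) times the Poisson integral of its boundary values
(`IsBoundedType.exists_norm_sq_le_poisson`). Nonpositive mean type and a Phragmén-Lindelöf argument
remove the exponential away from the real line (`IsBoundedType.isHardy`). A contour argument then
yields Cauchy's theorem (`IsHardy.integral_eq_zero`), from which the orthogonality, the reproducing
property (`IsHermiteBiehler.inner_kernelElem`) and the bounds on point evaluations follow. -/

/-! ### The Poisson-Jensen inequality on a disc -/

/-- The canonical factors have modulus at least one inside the disc. -/
theorem one_le_norm_canonicalFactor {R : ℝ} {a w : ℂ} (ha : a ∈ Metric.ball (0 : ℂ) R)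
    (hw : w ∈ Metric.ball (0 : ℂ) R) (hne : w ≠ a) : 1 ≤ ‖Complex.canonicalFactor R a w‖ := by
  have hR : 0 < R := Metric.pos_of_mem_ball hw
  rw [mem_ball_zero_iff] at ha hw
  have hpos : 0 < ‖(R : ℂ) * (w - a)‖ := by
    simp [hR.ne', sub_eq_zero, hne]
  rw [Complex.canonicalFactor_apply, norm_div, one_le_div hpos]
  refine le_of_sq_le_sq ?_ (norm_nonneg _)
  rw [norm_mul, mul_pow, Complex.norm_real, Real.norm_eq_abs, sq_abs, Complex.sq_norm,
    Complex.sq_norm]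
  have h1 : ‖a‖ ^ 2 ≤ R ^ 2 := by gcongr
  have h2 : ‖w‖ ^ 2 ≤ R ^ 2 := by gcongr
  rw [Complex.sq_norm] at h1 h2
  simp only [Complex.normSq_apply, Complex.sub_re, Complex.sub_im, Complex.mul_re, Complex.mul_im,
    Complex.conj_re, Complex.conj_im, ← Complex.ofReal_pow, Complex.ofReal_re,
    Complex.ofReal_im] at *
  -- The difference of the squared moduli factors: |R² - conj(a) w|² - R² |w - a|² = (R² - |a|²)(R²
  -- - |w|²).
  nlinarith [mul_nonneg (sub_nonneg.2 h1) (sub_nonneg.2 h2)]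

/-- The Poisson-Jensen inequality: `log ‖U‖` is subharmonic. -/
theorem log_norm_le_circleAverage_poissonKernel {U : ℂ → ℂ} {R : ℝ} {w : ℂ}
    (hU : AnalyticOnNhd ℂ U (Metric.closedBall 0 R)) (hw : w ∈ Metric.ball (0 : ℂ) R)
    (hS : ∀ ζ ∈ Metric.sphere (0 : ℂ) R, U ζ ≠ 0) (hUw : U w ≠ 0) :
    Real.log ‖U w‖ ≤
      Real.circleAverage (fun ζ => poissonKernel 0 w ζ * Real.log ‖U ζ‖) 0 R := by
  have hR : 0 < R := Metric.pos_of_mem_ball hw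
  have hwc : w ∈ Metric.closedBall (0 : ℂ) R := Metric.ball_subset_closedBall hw
  have hpre : IsPreconnected (Metric.closedBall (0 : ℂ) R) :=
    (convex_closedBall 0 R).isPreconnected
  have ord0 : ∀ ζ ∈ Metric.closedBall (0 : ℂ) R, U ζ ≠ 0 → meromorphicOrderAt U ζ = 0 := by
    intro ζ hζ hne
    rw [(hU ζ hζ).meromorphicOrderAt_eq, (hU ζ hζ).analyticOrderAt_eq_zero.2 hne]
    rfl
  have hord : ∀ u : Metric.closedBall (0 : ℂ) R, meromorphicOrderAt U u ≠ ⊤ := by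
    rw [← hU.meromorphicOn.exists_meromorphicOrderAt_ne_top_iff_forall
      ⟨⟨w, hwc⟩, hpre⟩]
    exact ⟨⟨w, hwc⟩, by simp [ord0 w hwc hUw]⟩
  -- `h` is `U` with its zeros in the disc removed by canonical factors. It has no zeros, has the
  -- modulus of `U` on the circle and is at least as large at `w`, so the Poisson formula for the
  -- harmonic function log ‖h‖ gives the claim.
  obtain ⟨h, D⟩ := hU.meromorphicOn.exists_ecanonicalDecomp hord
  have hsph : MeromorphicOn.divisor U (Metric.sphere (0 : ℂ) R) = 0 := by
    ext x
    by_cases hx : x ∈ Metric.sphere (0 : ℂ) R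
    · rw [MeromorphicOn.divisor_apply (hU.meromorphicOn.mono_set Metric.sphere_subset_closedBall)
        hx, ord0 x (Metric.sphere_subset_closedBall hx) (hS x hx)]
      rfl
    · exact Function.locallyFinsuppWithin.apply_eq_zero_of_notMem _ hx
  have key : ∀ ζ ∈ Metric.closedBall (0 : ℂ) R, U ζ ≠ 0 → Real.log ‖h ζ‖ =
      (∑ᶠ i, (MeromorphicOn.divisor U (Metric.ball 0 R) i) *
        Real.log ‖Complex.canonicalFactor R i ζ‖) + Real.log ‖U ζ‖ := by
    intro ζ hζ hne
    rw [D.log_norm_eq hζ (ord0 ζ hζ hne) hR, hsph,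
      (hU ζ hζ).meromorphicTrailingCoeffAt_of_ne_zero hne]
    simp
  have hle : Real.log ‖U w‖ ≤ Real.log ‖h w‖ := by
    rw [key w hwc hUw]
    refine le_add_of_nonneg_left (finsum_nonneg fun i => ?_)
    have hmero : AnalyticOnNhd ℂ U (Metric.ball 0 R) := hU.mono Metric.ball_subset_closedBall
    by_cases hi : i ∈ Metric.ball (0 : ℂ) R
    · by_cases hiw : w = i
      · subst hiw; simp
      · exact mul_nonneg (mod_cast MeromorphicOn.AnalyticOnNhd.divisor_nonneg hmero i)
          (Real.log_nonneg (one_le_norm_canonicalFactor hi hw hiw))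
    · simp [hi]
  refine hle.trans ?_
  have hharm : InnerProductSpace.HarmonicOnNhd (fun ζ => Real.log ‖h ζ‖) (Metric.closedBall 0 R) :=
    fun ζ hζ => (D.analyticOnNhd ζ hζ).harmonicAt_log_norm (D.ne_zero ζ hζ)
  rw [← hharm.circleAverage_poissonKernel_smul hw]
  refine le_of_eq (Real.circleAverage_congr_sphere fun ζ hζ => ?_)
  rw [abs_of_pos hR] at hζ
  simp only [Pi.smul_apply', smul_eq_mul]
  rw [key ζ (Metric.sphere_subset_closedBall hζ) (hS ζ hζ), finsum_eq_zero_of_forall_eq_zero,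
    zero_add]
  intro i
  by_cases hi : i ∈ Metric.ball (0 : ℂ) R
  · rw [Complex.norm_canonicalFactor_eval_circle_eq_one hi hζ]; simp
  · simp [hi]

theorem circleAverage_poissonKernel {R : ℝ} {w : ℂ} (hw : w ∈ Metric.ball (0 : ℂ) R) :
    Real.circleAverage (poissonKernel 0 w) 0 R = 1 := by
  have hharm : InnerProductSpace.HarmonicOnNhd (fun _ : ℂ => (1 : ℝ)) (Metric.closedBall 0 R) :=
    fun ζ _ => by
      simp
  have h := hharm.circleAverage_poissonKernel_smul hw
  rw [← h]
  congr 1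
  ext ζ
  simp

theorem continuousOn_poissonKernel {w : ℂ} : ContinuousOn (poissonKernel 0 w) {w}ᶜ := by
  unfold poissonKernel
  refine ContinuousOn.div (by fun_prop) (by fun_prop) fun z hz => ?_
  simpa [sub_eq_zero] using hz

theorem poissonKernel_nonneg {w ζ : ℂ} (h : ‖w‖ ≤ ‖ζ‖) : 0 ≤ poissonKernel 0 w ζ := by
  unfold poissonKernel
  have : ‖w‖ ^ 2 ≤ ‖ζ‖ ^ 2 := by gcongr
  refine div_nonneg ?_ (by positivity)
  simpa using this

/-- A form of the Poisson-Jensen inequality for a quotient of functions bounded by one, in which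
the numerator and the denominator do not vanish on the circle: near a given point of the circle
the denominator controls the boundary values, elsewhere the square of the modulus does. -/
theorem two_mul_log_norm_le_of_quotient {U P Q : ℂ → ℂ} {R η S c : ℝ} {w : ℂ}
    (hU : AnalyticOnNhd ℂ U (Metric.closedBall 0 R))
    (hQ : AnalyticOnNhd ℂ Q (Metric.closedBall 0 R))
    (hw : w ∈ Metric.ball (0 : ℂ) R) (hUw : U w ≠ 0) (hQ0 : Q 0 ≠ 0)
    (hUQ : ∀ ζ ∈ Metric.sphere (0 : ℂ) R, U ζ * Q ζ = P ζ)
    (hP : ∀ ζ ∈ Metric.sphere (0 : ℂ) R, P ζ ≠ 0)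
    (hP1 : ∀ ζ ∈ Metric.sphere (0 : ℂ) R, ‖P ζ‖ ≤ 1)
    (hQ1 : ∀ ζ ∈ Metric.sphere (0 : ℂ) R, ‖Q ζ‖ ≤ 1)
    (hη : 0 < η) (hηπ : η < Real.pi) (hS : 0 ≤ S)
    (hPS : ∀ θ ∈ Set.Icc (-η) η, poissonKernel 0 w (circleMap 0 R θ) ≤ S) (hc : 0 < c) :
    2 * Real.log ‖U w‖ ≤ Real.log c - 1 +
      S * (-2 * Real.log ‖Q 0‖ + η * |Real.log c - 1| / Real.pi) +
      (2 * Real.pi)⁻¹ * ((∫ θ in η..(2 * Real.pi - η),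
        poissonKernel 0 w (circleMap 0 R θ) * ‖U (circleMap 0 R θ)‖ ^ 2) / c) := by
  have hR : 0 < R := Metric.pos_of_mem_ball hw
  have hπ := Real.pi_pos
  set γ := circleMap 0 R with hγ
  have hγS : ∀ θ, γ θ ∈ Metric.sphere (0 : ℂ) R := fun θ => circleMap_mem_sphere 0 hR.le θ
  have hγB : ∀ θ, γ θ ∈ Metric.closedBall (0 : ℂ) R := fun θ =>
    Metric.sphere_subset_closedBall (hγS θ)
  have hU0 : ∀ ζ ∈ Metric.sphere (0 : ℂ) R, U ζ ≠ 0 := fun ζ hζ h =>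
    hP ζ hζ (by rw [← hUQ ζ hζ, h, zero_mul])
  have hQne : ∀ ζ ∈ Metric.sphere (0 : ℂ) R, Q ζ ≠ 0 := fun ζ hζ h =>
    hP ζ hζ (by rw [← hUQ ζ hζ, h, mul_zero])
  have hγw : ∀ θ, γ θ ≠ w := fun θ h => by
    have h1 := hγS θ
    rw [h, mem_sphere_zero_iff_norm] at h1
    rw [mem_ball_zero_iff] at hw
    exact hw.ne h1
  have cγ : Continuous γ := continuous_circleMap 0 R
  have cP : Continuous fun θ => poissonKernel 0 w (γ θ) :=
    continuousOn_poissonKernel.comp_continuous cγ hγw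
  have cU : Continuous fun θ => U (γ θ) := hU.continuousOn.comp_continuous cγ hγB
  have cQ : Continuous fun θ => Q (γ θ) := hQ.continuousOn.comp_continuous cγ hγB
  have clU : Continuous fun θ => Real.log ‖U (γ θ)‖ :=
    cU.norm.log fun θ => norm_ne_zero_iff.2 (hU0 _ (hγS θ))
  have clQ : Continuous fun θ => Real.log ‖Q (γ θ)‖ :=
    cQ.norm.log fun θ => norm_ne_zero_iff.2 (hQne _ (hγS θ))
  have hP0 : ∀ θ, 0 ≤ poissonKernel 0 w (γ θ) := fun θ => poissonKernel_nonneg <| by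
    rw [mem_sphere_zero_iff_norm.1 (hγS θ)]
    exact (mem_ball_zero_iff.1 hw).le
  have hlogQ : ∀ θ, Real.log ‖Q (γ θ)‖ ≤ 0 := fun θ =>
    Real.log_nonpos (norm_nonneg _) (hQ1 _ (hγS θ))
  have hlogU : ∀ θ, Real.log ‖U (γ θ)‖ ≤ -Real.log ‖Q (γ θ)‖ := fun θ => by
    have h1 : Real.log ‖P (γ θ)‖ ≤ 0 := Real.log_nonpos (norm_nonneg _) (hP1 _ (hγS θ))
    rw [← hUQ _ (hγS θ), norm_mul, Real.log_mul (norm_ne_zero_iff.2 (hU0 _ (hγS θ)))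
      (norm_ne_zero_iff.2 (hQne _ (hγS θ)))] at h1
    linarith
  -- periodic shift
  have shift : ∀ f : ℂ → ℝ, ∫ θ in (0 : ℝ)..(2 * Real.pi), f (γ θ) =
      ∫ θ in (-η)..(2 * Real.pi - η), f (γ θ) := fun f => by
    have hper : Function.Periodic (fun θ => f (γ θ)) (2 * Real.pi) := fun θ => by
      simp only [hγ, periodic_circleMap 0 R θ]
    have := hper.intervalIntegral_add_eq 0 (-η)
    rw [zero_add] at this
    rw [this]; congr 1; ring
  -- the denominator
  have hQavg : ∫ θ in (-η)..(2 * Real.pi - η), -Real.log ‖Q (γ θ)‖ ≤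
      2 * Real.pi * (-Real.log ‖Q 0‖) := by
    have h := log_norm_le_circleAverage_poissonKernel hQ (Metric.mem_ball_self hR) hQne hQ0
    rw [Real.circleAverage_def, shift (fun ζ => poissonKernel 0 0 ζ * Real.log ‖Q ζ‖)] at h
    have h0 : ∀ θ, poissonKernel 0 0 (γ θ) = 1 := fun θ => by
      have : ‖γ θ‖ = R := mem_sphere_zero_iff_norm.1 (hγS θ)
      simp [poissonKernel, this, hR.ne']
    simp only [h0, one_mul, smul_eq_mul] at h
    rw [intervalIntegral.integral_neg]
    rw [inv_mul_eq_div, le_div_iff₀ (by positivity)] at h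
    linarith
  -- the numerator
  set k := Real.log c - 1 with hk
  have hmain := log_norm_le_circleAverage_poissonKernel hU hw hU0 hUw
  have hone := circleAverage_poissonKernel hw
  rw [Real.circleAverage_def, smul_eq_mul,
    shift (fun ζ => poissonKernel 0 w ζ * Real.log ‖U ζ‖)] at hmain
  rw [Real.circleAverage_def, smul_eq_mul, shift] at hone
  set G : ℝ → ℝ := fun θ => poissonKernel 0 w (γ θ) * (2 * Real.log ‖U (γ θ)‖ - k) with hG
  have cG : Continuous G := by fun_prop
  have hsum : ∫ θ in (-η)..(2 * Real.pi - η), G θ =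
      2 * (∫ θ in (-η)..(2 * Real.pi - η), poissonKernel 0 w (γ θ) * Real.log ‖U (γ θ)‖) -
        k * ∫ θ in (-η)..(2 * Real.pi - η), poissonKernel 0 w (γ θ) := by
    rw [← intervalIntegral.integral_const_mul, ← intervalIntegral.integral_const_mul,
      ← intervalIntegral.integral_sub
        (Continuous.intervalIntegrable (by fun_prop) _ _)
        (Continuous.intervalIntegrable (by fun_prop) _ _)]
    refine intervalIntegral.integral_congr fun θ _ => ?_
    simp only [hG]; ring
  have hstart : 2 * Real.log ‖U w‖ ≤ k +
      (2 * Real.pi)⁻¹ * ∫ θ in (-η)..(2 * Real.pi - η), G θ := by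
    rw [hsum]
    linear_combination 2 * hmain + k * hone
  rw [← intervalIntegral.integral_add_adjacent_intervals (b := η)
    (cG.intervalIntegrable _ _) (cG.intervalIntegrable _ _)] at hstart
  -- On the short arc only |U| ≤ 1 / |Q| is used. Since -log |Q| ≥ 0, its integral over the arc is
  -- at most that over the circle, which Jensen's inequality at the centre bounds independently of
  -- `R`.
  have houter : ∫ θ in (-η)..η, G θ ≤
      S * (2 * (2 * Real.pi * (-Real.log ‖Q 0‖)) + 2 * η * |k|) := by
    have h1 : ∫ θ in (-η)..η, G θ ≤
        ∫ θ in (-η)..η, S * (2 * (-Real.log ‖Q (γ θ)‖) + |k|) := by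
      refine intervalIntegral.integral_mono_on (by linarith) (cG.intervalIntegrable _ _)
        (Continuous.intervalIntegrable (by fun_prop) _ _) fun θ hθ => ?_
      have h2 : 0 ≤ 2 * (-Real.log ‖Q (γ θ)‖) + |k| := by
        have := hlogQ θ; have := abs_nonneg k; linarith
      have h3 : 2 * Real.log ‖U (γ θ)‖ - k ≤ 2 * (-Real.log ‖Q (γ θ)‖) + |k| := by
        have := hlogU θ; have := neg_abs_le k; linarith
      calc G θ ≤ poissonKernel 0 w (γ θ) * (2 * (-Real.log ‖Q (γ θ)‖) + |k|) :=
            mul_le_mul_of_nonneg_left h3 (hP0 θ)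
        _ ≤ _ := mul_le_mul_of_nonneg_right (hPS θ hθ) h2
    refine h1.trans ?_
    rw [intervalIntegral.integral_const_mul]
    refine mul_le_mul_of_nonneg_left ?_ hS
    rw [intervalIntegral.integral_add (Continuous.intervalIntegrable (by fun_prop) _ _)
      (Continuous.intervalIntegrable (by fun_prop) _ _), intervalIntegral.integral_const_mul,
      intervalIntegral.integral_const, smul_eq_mul]
    have h4 : ∫ θ in (-η)..η, -Real.log ‖Q (γ θ)‖ ≤
        ∫ θ in (-η)..(2 * Real.pi - η), -Real.log ‖Q (γ θ)‖ := by
      rw [← intervalIntegral.integral_add_adjacent_intervals (b := η)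
        (f := fun θ => -Real.log ‖Q (γ θ)‖)
        (clQ.neg.intervalIntegrable _ _) (clQ.neg.intervalIntegrable _ (2 * Real.pi - η))]
      refine le_add_of_nonneg_right ?_
      exact intervalIntegral.integral_nonneg (by linarith) fun θ _ => by
        have := hlogQ θ; linarith
    linarith
  have hmid : ∫ θ in η..(2 * Real.pi - η), G θ ≤ (∫ θ in η..(2 * Real.pi - η),
        poissonKernel 0 w (γ θ) * ‖U (γ θ)‖ ^ 2) / c := by
    rw [← intervalIntegral.integral_div]
    refine intervalIntegral.integral_mono_on (by linarith) (cG.intervalIntegrable _ _)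
      (((cP.mul (cU.norm.pow 2)).div_const c).intervalIntegrable _ _) fun θ _ => ?_
    rw [hG, mul_div_assoc]
    refine mul_le_mul_of_nonneg_left ?_ (hP0 θ)
    have hpos : 0 < ‖U (γ θ)‖ := norm_pos_iff.2 (hU0 _ (hγS θ))
    have h5 := Real.log_le_sub_one_of_pos (show 0 < ‖U (γ θ)‖ ^ 2 / c by positivity)
    rw [Real.log_div (by positivity) hc.ne', Real.log_pow] at h5
    push_cast at h5
    linarith
  refine hstart.trans ?_
  have hinv : 0 ≤ (2 * Real.pi)⁻¹ := by positivity
  have hfin := mul_le_mul_of_nonneg_left (add_le_add houter hmid) hinv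
  have hexp : (2 * Real.pi)⁻¹ * (S * (2 * (2 * Real.pi * (-Real.log ‖Q 0‖)) + 2 * η * |k|)) =
      S * (-2 * Real.log ‖Q 0‖ + η * |k| / Real.pi) := by
    field_simp
  rw [mul_add _ _ (_ / c), hexp] at hfin
  linarith

/-! ### Passage to the unit circle with an exceptional boundary point -/

/-- The zeros of an analytic function on a connected set are countable. -/
theorem AnalyticOnNhd.countable_zeros {f : ℂ → ℂ} {S : Set ℂ} (hf : AnalyticOnNhd ℂ f S)
    (hS : IsPreconnected S) {x : ℂ} (hx : x ∈ S) (hfx : f x ≠ 0) :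
    {z ∈ S | f z = 0}.Countable := by
  refine (HereditarilyLindelofSpace.isLindelof _).countable_of_isDiscrete ?_
  have h1 := hf.preimage_zero_mem_codiscreteWithin hfx hx ⟨⟨x, hx⟩, hS⟩
  have h2 := Filter.codiscreteWithin_mono (U₁ := {z ∈ S | f z = 0}) (fun z hz => hz.1) h1
  rw [← Set.inter_self {z ∈ S | f z = 0}]
  refine isDiscrete_of_codiscreteWithin ?_
  filter_upwards [h2, Filter.self_mem_codiscreteWithin {z ∈ S | f z = 0}] with z hz hz'
  exact absurd hz'.2 (by simpa using hz)

/-- Supplies radii close to `a` whose circles avoid a countable set of zeros. Zeros may accumulate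
at the boundary, so such radii can only be had frequently, not eventually. -/
theorem frequently_notMem_of_countable {B : Set ℝ} (hB : B.Countable) (a : ℝ) :
    ∃ᶠ r in 𝓝[<] a, r ∉ B := by
  intro h
  obtain ⟨l, hl, hsub⟩ := mem_nhdsLT_iff_exists_Ioo_subset.1 h
  obtain ⟨r, hr, hr'⟩ := (hB.dense_compl ℝ).exists_between hl
  exact hsub hr' hr

theorem circleMap_ne_one {r θ : ℝ} (hr : 0 < r) (h0 : 0 < θ) (h1 : θ < 2 * Real.pi) :
    circleMap 0 r θ ≠ 1 := by
  intro h
  have hn := congrArg norm h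
  simp only [norm_circleMap_zero, abs_of_pos hr, norm_one] at hn
  subst hn
  rw [circleMap_zero, Complex.ofReal_one, one_mul, Complex.exp_eq_one_iff] at h
  obtain ⟨n, hn⟩ := h
  have h2 : θ = n * (2 * Real.pi) := by
    have := congrArg Complex.im hn
    simpa using this
  have hπ := Real.pi_pos
  have h3 : (0 : ℝ) < n := by
    by_contra hcon
    have : (n : ℝ) * (2 * Real.pi) ≤ 0 := mul_nonpos_of_nonpos_of_nonneg (not_lt.1 hcon)
      (by positivity)
    linarith
  have h4 : (n : ℝ) < 1 := by
    by_contra hcon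
    have : 1 * (2 * Real.pi) ≤ n * (2 * Real.pi) :=
      mul_le_mul_of_nonneg_right (not_lt.1 hcon) (by positivity)
    linarith
  have h5 : 0 < n := by exact_mod_cast h3
  have h6 : n < 1 := by exact_mod_cast h4
  omega

theorem continuous_circleMap_uncurry :
    Continuous fun p : ℝ × ℝ => circleMap 0 p.1 p.2 := by
  simp only [circleMap]; fun_prop

/-- Circular arcs that avoid the point `1` can be moved to the unit circle. -/
theorem tendsto_intervalIntegral_circleMap {F : ℂ → ℝ} {η r₀ : ℝ} (hη : 0 < η)
    (hηπ : η < Real.pi) (hr₀ : 0 < r₀) (hr₁ : r₀ < 1)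
    (hF : ContinuousOn F {ζ | r₀ ≤ ‖ζ‖ ∧ ‖ζ‖ ≤ 1 ∧ ζ ≠ 1}) :
    Tendsto (fun r => ∫ θ in η..(2 * Real.pi - η), F (circleMap 0 r θ)) (𝓝[<] 1)
      (𝓝 (∫ θ in η..(2 * Real.pi - η), F (circleMap 0 1 θ))) := by
  set K : Set (ℝ × ℝ) := Set.Icc r₀ 1 ×ˢ Set.Icc η (2 * Real.pi - η) with hK
  have hmaps : Set.MapsTo (fun p : ℝ × ℝ => circleMap 0 p.1 p.2) K
      {ζ | r₀ ≤ ‖ζ‖ ∧ ‖ζ‖ ≤ 1 ∧ ζ ≠ 1} := by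
    rintro ⟨r, θ⟩ ⟨⟨hr, hr'⟩, hθ, hθ'⟩
    have hr0 : 0 < r := hr₀.trans_le hr
    refine ⟨?_, ?_, circleMap_ne_one hr0 (hη.trans_le hθ) (by dsimp at *; linarith)⟩ <;>
      simpa [abs_of_pos hr0]
  have hG : ContinuousOn (fun p : ℝ × ℝ => F (circleMap 0 p.1 p.2)) K :=
    hF.comp continuous_circleMap_uncurry.continuousOn hmaps
  have hKc : IsCompact K := isCompact_Icc.prod isCompact_Icc
  obtain ⟨M, hM⟩ := hKc.exists_bound_of_continuousOn hG
  have huI : Set.uIoc η (2 * Real.pi - η) ⊆ Set.Icc η (2 * Real.pi - η) := by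
    rw [Set.uIoc_of_le (by linarith)]; exact Set.Ioc_subset_Icc_self
  have hev : ∀ᶠ r in 𝓝[<] (1 : ℝ), r ∈ Set.Icc r₀ 1 := by
    filter_upwards [Ioo_mem_nhdsLT hr₁] with r hr using ⟨hr.1.le, hr.2.le⟩
  have hone : (1 : ℝ) ∈ Set.Icc r₀ 1 := ⟨hr₁.le, le_rfl⟩
  refine intervalIntegral.tendsto_integral_filter_of_dominated_convergence (fun _ => M) ?_ ?_ ?_ ?_
  · filter_upwards [hev] with r hr
    refine ContinuousOn.aestronglyMeasurable ?_ measurableSet_uIoc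
    exact hG.comp (f := fun θ => (r, θ)) (by fun_prop) fun θ hθ => ⟨hr, huI hθ⟩
  · filter_upwards [hev] with r hr
    exact ae_of_all _ fun θ hθ => hM (r, θ) ⟨hr, huI hθ⟩
  · exact intervalIntegrable_const
  · refine ae_of_all _ fun θ hθ => ?_
    have h1 : Tendsto (fun r : ℝ => (r, θ)) (𝓝[<] 1) (𝓝[K] (1, θ)) := by
      refine tendsto_nhdsWithin_iff.2 ⟨?_, ?_⟩
      · exact Tendsto.mono_left (Continuous.tendsto (by fun_prop) _) nhdsWithin_le_nhds
      · filter_upwards [hev] with r hr using ⟨hr, huI hθ⟩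
    exact (hG (1, θ) ⟨hone, huI hθ⟩).tendsto.comp h1

theorem norm_circleMap_sub_one_le {r θ : ℝ} (hr : 0 ≤ r) (hr1 : r ≤ 1) :
    ‖circleMap 0 r θ - 1‖ ≤ (1 - r) + |θ| := by
  have h : circleMap 0 r θ - 1 = r * (Complex.exp (Complex.I * θ) - 1) - ((1 - r : ℝ) : ℂ) := by
    rw [circleMap_zero, mul_comm Complex.I]; push_cast; ring
  rw [h]
  have h1 : ‖Complex.exp (Complex.I * θ) - 1‖ ≤ |θ| := by
    simpa using Real.norm_exp_I_mul_ofReal_sub_one_le (x := θ)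
  calc _ ≤ ‖(r : ℂ) * (Complex.exp (Complex.I * θ) - 1)‖ + ‖((1 - r : ℝ) : ℂ)‖ := norm_sub_le _ _
    _ ≤ 1 * |θ| + (1 - r) := by
      rw [norm_mul, Complex.norm_real, Complex.norm_real, Real.norm_of_nonneg hr,
        Real.norm_of_nonneg (by linarith)]
      gcongr
    _ = _ := by ring

/-- Let `U = P / Q` in the unit disc with `P`, `Q` bounded by one, and let `U` be continuous up to
the circle except at `1`. Then `log ‖U‖` is bounded by the sum of a multiple of the Poisson kernel
with pole `1` and a quantity controlled by the boundary values. -/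
theorem two_mul_log_norm_le_of_quotient_ball {U P Q : ℂ → ℂ} {w : ℂ} {c J : ℝ}
    (hU : AnalyticOnNhd ℂ U (Metric.ball 0 1))
    (hUc : ContinuousOn U (Metric.closedBall 0 1 \ {1}))
    (hQ : AnalyticOnNhd ℂ Q (Metric.ball 0 1))
    (hUQ : ∀ ζ ∈ Metric.ball (0 : ℂ) 1, U ζ * Q ζ = P ζ)
    (hP1 : ∀ ζ ∈ Metric.ball (0 : ℂ) 1, ‖P ζ‖ ≤ 1)
    (hQ1 : ∀ ζ ∈ Metric.ball (0 : ℂ) 1, ‖Q ζ‖ ≤ 1)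
    (hw : w ∈ Metric.ball (0 : ℂ) 1) (hUw : U w ≠ 0) (hQ0 : Q 0 ≠ 0) (hc : 0 < c)
    (hJ : ∀ η, 0 < η → η < Real.pi → ∫ θ in η..(2 * Real.pi - η),
      poissonKernel 0 w (circleMap 0 1 θ) * ‖U (circleMap 0 1 θ)‖ ^ 2 ≤ 2 * Real.pi * J) :
    2 * Real.log ‖U w‖ ≤
      Real.log c - 1 + poissonKernel 0 w 1 * (-2 * Real.log ‖Q 0‖) + J / c := by
  have hπ := Real.pi_pos
  have hw1 : ‖w‖ < 1 := mem_ball_zero_iff.1 hw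
  have hpre : IsPreconnected (Metric.ball (0 : ℂ) 1) := (convex_ball 0 1).isPreconnected
  -- The radii of the circles that meet a zero of `U` or of `Q`.
  set B : Set ℝ := norm '' {z ∈ Metric.ball (0 : ℂ) 1 | U z = 0} ∪
    norm '' {z ∈ Metric.ball (0 : ℂ) 1 | Q z = 0} with hB
  have hBc : B.Countable := ((hU.countable_zeros hpre hw hUw).image _).union
    ((hQ.countable_zeros hpre (Metric.mem_ball_self one_pos) hQ0).image _)
  have hw1' : (1 : ℂ) ≠ w := fun h => by rw [← h, norm_one] at hw1; exact lt_irrefl _ hw1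
  have hpc : ContinuousAt (poissonKernel 0 w) 1 :=
    continuousOn_poissonKernel.continuousAt (isOpen_compl_singleton.mem_nhds hw1')
  have hp0 : 0 ≤ poissonKernel 0 w 1 := poissonKernel_nonneg (by simpa using hw1.le)
  -- Three limits are taken in this order: r → 1 with the arc fixed, then η → 0, then δ → 0. By
  -- continuity the Poisson kernel is at most its value at `1` plus δ on short arcs of radius close
  -- to one.
  have hle : ∀ δ, 0 < δ → ∀ᶠ η in 𝓝[>] (0 : ℝ), 2 * Real.log ‖U w‖ ≤ Real.log c - 1 +
      (poissonKernel 0 w 1 + δ) * (-2 * Real.log ‖Q 0‖ + η * |Real.log c - 1| / Real.pi) +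
      J / c := by
    intro δ hδ
    obtain ⟨ρ, hρ, hρ'⟩ := Metric.continuousAt_iff.1 hpc δ hδ
    filter_upwards [Ioo_mem_nhdsGT (show (0 : ℝ) < min (ρ / 2) Real.pi by positivity)]
      with η ⟨hη, hη'⟩
    have hηρ : η < ρ / 2 := hη'.trans_le (min_le_left _ _)
    have hηπ : η < Real.pi := hη'.trans_le (min_le_right _ _)
    set T : ℝ → ℝ := fun r => ∫ θ in η..(2 * Real.pi - η),
      poissonKernel 0 w (circleMap 0 r θ) * ‖U (circleMap 0 r θ)‖ ^ 2 with hT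
    have hlim : Tendsto T (𝓝[<] 1) (𝓝 (T 1)) := by
      refine tendsto_intervalIntegral_circleMap
        (F := fun ζ => poissonKernel 0 w ζ * ‖U ζ‖ ^ 2) (r₀ := (‖w‖ + 1) / 2) hη hηπ
        (by positivity) (by linarith) ?_
      refine ContinuousOn.mul (continuousOn_poissonKernel.mono ?_) ((hUc.mono ?_).norm.pow 2)
      · rintro ζ ⟨h1, -⟩ rfl
        linarith
      · rintro ζ ⟨-, h2, h3⟩
        exact ⟨mem_closedBall_zero_iff.2 h2, h3⟩
    have hfreq : ∃ᶠ r in 𝓝[<] (1 : ℝ), 2 * Real.log ‖U w‖ ≤ Real.log c - 1 +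
        (poissonKernel 0 w 1 + δ) * (-2 * Real.log ‖Q 0‖ + η * |Real.log c - 1| / Real.pi) +
        (2 * Real.pi)⁻¹ * (T r / c) := by
      have hgood : ∀ᶠ r in 𝓝[<] (1 : ℝ), r ∈ Set.Ioo (max ‖w‖ (1 - ρ / 2)) 1 :=
        Ioo_mem_nhdsLT (max_lt hw1 (by linarith))
      refine ((frequently_notMem_of_countable hBc 1).and_eventually hgood).mono ?_
      rintro r ⟨hrB, hr, hr1⟩
      have hrw : ‖w‖ < r := (le_max_left _ _).trans_lt hr
      have hrρ : 1 - ρ / 2 < r := (le_max_right _ _).trans_lt hr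
      have hr0 : 0 < r := (norm_nonneg w).trans_lt hrw
      have hsub : Metric.closedBall (0 : ℂ) r ⊆ Metric.ball 0 1 := Metric.closedBall_subset_ball hr1
      have hsub' : Metric.sphere (0 : ℂ) r ⊆ Metric.ball 0 1 :=
        Metric.sphere_subset_closedBall.trans hsub
      refine two_mul_log_norm_le_of_quotient (hU.mono hsub) (hQ.mono hsub)
        (mem_ball_zero_iff.2 hrw) hUw hQ0 (fun ζ hζ => hUQ ζ (hsub' hζ)) ?_
        (fun ζ hζ => hP1 ζ (hsub' hζ)) (fun ζ hζ => hQ1 ζ (hsub' hζ)) hη hηπ (by positivity)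
        ?_ hc
      · intro ζ hζ h0
        rw [← hUQ ζ (hsub' hζ), mul_eq_zero] at h0
        refine hrB ?_
        rw [← mem_sphere_zero_iff_norm.1 hζ]
        exact h0.imp (fun h => ⟨ζ, ⟨hsub' hζ, h⟩, rfl⟩) (fun h => ⟨ζ, ⟨hsub' hζ, h⟩, rfl⟩)
      · intro θ hθ
        have hd : dist (circleMap 0 r θ) 1 < ρ := by
          rw [dist_eq_norm]
          have := norm_circleMap_sub_one_le (θ := θ) hr0.le hr1.le
          have := abs_le.2 hθ
          linarith
        have := hρ' hd
        rw [Real.dist_eq] at this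
        have := (abs_lt.1 this).2
        linarith
    have hle : 2 * Real.log ‖U w‖ ≤ Real.log c - 1 +
        (poissonKernel 0 w 1 + δ) * (-2 * Real.log ‖Q 0‖ + η * |Real.log c - 1| / Real.pi) +
        (2 * Real.pi)⁻¹ * (T 1 / c) :=
      ge_of_tendsto_of_frequently
        (tendsto_const_nhds.add ((hlim.div_const c).const_mul _)) hfreq
    refine hle.trans ?_
    have h2 : (2 * Real.pi)⁻¹ * (T 1 / c) ≤ J / c := by
      rw [← mul_div_assoc]
      gcongr
      rw [inv_mul_le_iff₀ (by positivity)]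
      exact hJ η hη hηπ
    linarith
  have hle' : ∀ δ, 0 < δ → 2 * Real.log ‖U w‖ ≤ Real.log c - 1 +
      (poissonKernel 0 w 1 + δ) * (-2 * Real.log ‖Q 0‖) + J / c := by
    intro δ hδ
    refine ge_of_tendsto (x := 𝓝[>] (0 : ℝ)) ?_ (hle δ hδ)
    refine Tendsto.mono_left (Continuous.tendsto' (by fun_prop) _ _ ?_) nhdsWithin_le_nhds
    simp
  refine ge_of_tendsto (x := 𝓝[>] (0 : ℝ)) ?_ (eventually_nhdsWithin_of_forall hle')
  refine Tendsto.mono_left (Continuous.tendsto' (by fun_prop) _ _ ?_) nhdsWithin_le_nhds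
  simp

/-! ### Transfer to the upper half-plane -/

/-- The Cayley transform from the unit disc to the upper half-plane. -/
def cayley (ζ : ℂ) : ℂ := Complex.I * (1 + ζ) / (1 - ζ)

/-- The Poisson kernel with pole at the boundary point sent to infinity is the height in the
half-plane. Thus the pole term of the disc estimate becomes a multiple of Im z, that is, an
exponential factor. -/
theorem im_cayley (ζ : ℂ) : (cayley ζ).im = poissonKernel 0 ζ 1 := by
  have h : cayley ζ = Complex.I * (1 + ζ) * conj (1 - ζ) / ((‖1 - ζ‖ ^ 2 : ℝ) : ℂ) := by
    by_cases hζ : 1 - ζ = 0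
    · simp [cayley, hζ]
    · rw [cayley, div_eq_div_iff hζ (by simpa using hζ)]
      rw [← Complex.normSq_eq_norm_sq, Complex.normSq_eq_conj_mul_self]
      ring
  rw [h, Complex.div_ofReal_im, poissonKernel]
  congr 1
  · rw [sub_zero, sub_zero, norm_one, ← Complex.normSq_eq_norm_sq, Complex.normSq_apply]
    simp
    ring
  · simp

theorem cayley_inv {z : ℂ} (hz : z + Complex.I ≠ 0) :
    cayley ((z - Complex.I) / (z + Complex.I)) = z := by
  have h1 : 1 - (z - Complex.I) / (z + Complex.I) = 2 * Complex.I / (z + Complex.I) := by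
    field_simp; ring
  have h2 : 1 + (z - Complex.I) / (z + Complex.I) = 2 * z / (z + Complex.I) := by
    field_simp; ring
  rw [cayley, h1, h2]
  have := Complex.I_ne_zero
  field_simp

theorem one_sub_norm_cayley_inv_sq {z : ℂ} (hz : z + Complex.I ≠ 0) :
    1 - ‖(z - Complex.I) / (z + Complex.I)‖ ^ 2 = 4 * z.im / ‖z + Complex.I‖ ^ 2 := by
  have h0 : ‖z + Complex.I‖ ^ 2 ≠ 0 := by simpa using hz
  rw [norm_div, div_pow, one_sub_div h0]
  congr 1
  rw [Complex.sq_norm, Complex.sq_norm, Complex.normSq_apply, Complex.normSq_apply]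
  simp
  ring

theorem add_I_ne_zero {z : ℂ} (hz : 0 ≤ z.im) : z + Complex.I ≠ 0 := by
  intro h
  have := congrArg Complex.im h
  simp at this
  linarith

/-- The Poisson kernel of the disc in the half-plane coordinates. -/
theorem poissonKernel_cayley_inv {z : ℂ} (hz : 0 < z.im) (t : ℝ) :
    poissonKernel 0 ((z - Complex.I) / (z + Complex.I)) ((t - Complex.I) / (t + Complex.I)) =
      z.im * (1 + t ^ 2) / ‖(t : ℂ) - z‖ ^ 2 := by
  have hz0 := add_I_ne_zero hz.le
  have ht0 : (t : ℂ) + Complex.I ≠ 0 := add_I_ne_zero (by simp)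
  have h1 := one_sub_norm_cayley_inv_sq hz0
  have h2 := one_sub_norm_cayley_inv_sq ht0
  have h3 : ((t : ℂ) - Complex.I) / (t + Complex.I) - (z - Complex.I) / (z + Complex.I) =
      2 * Complex.I * (t - z) / ((t + Complex.I) * (z + Complex.I)) := by
    field_simp; ring
  have h4 : ‖(t : ℂ) + Complex.I‖ ^ 2 = 1 + t ^ 2 := by
    rw [Complex.sq_norm, Complex.normSq_apply]; simp; ring
  simp only [Complex.ofReal_im, mul_zero, zero_div] at h2
  have h5 : ‖((t : ℂ) - Complex.I) / (t + Complex.I)‖ ^ 2 = 1 := by linarith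
  rw [poissonKernel, sub_zero, sub_zero, h5, h1, h3, norm_div, norm_mul, norm_mul, norm_mul,
    div_pow, mul_pow, mul_pow, mul_pow, h4]
  have h6 : ‖z + Complex.I‖ ≠ 0 := norm_ne_zero_iff.2 hz0
  have h7 : 1 + t ^ 2 ≠ 0 := by positivity
  have h8 : ‖(t : ℂ) - z‖ ≠ 0 := norm_ne_zero_iff.2 fun h => by
    have := congrArg Complex.im h
    simp at this
    exact hz.ne' this
  simp only [Complex.norm_I, Complex.norm_two]
  field_simp
  ring

/-- The real parameter of a point of the unit circle. -/
def circleParam (θ : ℝ) : ℝ := -(Real.cos (θ / 2) / Real.sin (θ / 2))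

theorem circleMap_eq_circleParam {θ : ℝ} (h : Real.sin (θ / 2) ≠ 0) :
    circleMap 0 1 θ = (circleParam θ - Complex.I) / (circleParam θ + Complex.I) := by
  have hs : Complex.sin ((θ / 2 : ℝ) : ℂ) ≠ 0 := by
    rw [← Complex.ofReal_sin]; exact_mod_cast h
  set s : ℂ := ((θ / 2 : ℝ) : ℂ) with hs'
  have h1 : circleMap 0 1 θ = Complex.exp (s * Complex.I) * Complex.exp (s * Complex.I) := by
    rw [circleMap_zero, ← Complex.exp_add, hs']
    push_cast
    rw [one_mul]; congr 1; ring
  have h2 : (circleParam θ : ℂ) = -(Complex.cos s / Complex.sin s) := by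
    simp [circleParam, hs']
  have ht0 : (circleParam θ : ℂ) + Complex.I ≠ 0 := add_I_ne_zero (by simp)
  rw [eq_div_iff ht0, h1, h2, Complex.exp_mul_I]
  field_simp
  linear_combination ((Complex.cos s) * (-1 : ℂ) - Complex.sin s * Complex.I) *
    (Complex.sin_sq_add_cos_sq s) + (Complex.sin s ^ 2 * Complex.cos s + Complex.sin s ^ 3 * Complex.I) * Complex.I_sq

theorem sin_half_pos {θ : ℝ} (h0 : 0 < θ) (h1 : θ < 2 * Real.pi) : 0 < Real.sin (θ / 2) :=
  Real.sin_pos_of_pos_of_lt_pi (by linarith) (by linarith)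

theorem hasDerivAt_circleParam {θ : ℝ} (h : Real.sin (θ / 2) ≠ 0) :
    HasDerivAt circleParam ((1 + circleParam θ ^ 2) / 2) θ := by
  have h0 : HasDerivAt (fun x : ℝ => x / 2) (1 / 2) θ := (hasDerivAt_id θ).div_const 2
  have := ((h0.cos).div (h0.sin) h).neg
  refine this.congr_deriv ?_
  rw [circleParam]
  field_simp
  ring

/-- The Poisson integral over an arc in half-plane coordinates. -/
theorem integral_poissonKernel_arc_le {u : ℂ → ℂ} (hu : Continuous fun t : ℝ => u t)
    {z : ℂ} (hz : 0 < z.im) (hint : Integrable fun t : ℝ => ‖u t‖ ^ 2 / ‖(t : ℂ) - z‖ ^ 2)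
    {η : ℝ} (hη : 0 < η) (hηπ : η < Real.pi) :
    ∫ θ in η..(2 * Real.pi - η),
      poissonKernel 0 ((z - Complex.I) / (z + Complex.I)) (circleMap 0 1 θ) *
        ‖u (cayley (circleMap 0 1 θ))‖ ^ 2 ≤
      2 * Real.pi * (z.im / Real.pi * ∫ t : ℝ, ‖u t‖ ^ 2 / ‖(t : ℂ) - z‖ ^ 2) := by
  have hπ := Real.pi_pos
  have hne : ∀ t : ℝ, ‖(t : ℂ) - z‖ ≠ 0 := fun t => norm_ne_zero_iff.2 fun h => by
    have := congrArg Complex.im h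
    simp at this
    exact hz.ne' this
  -- With t = -cot(θ/2) one has dt = (1 + t²)/2 dθ, which cancels the factor 1 + t² of the
  -- transported Poisson kernel and leaves 2 Im z / |t - z|².
  set g : ℝ → ℝ := fun t => 2 * z.im * (‖u t‖ ^ 2 / ‖(t : ℂ) - z‖ ^ 2) with hg
  have cg : Continuous g := by
    refine continuous_const.mul (Continuous.div (hu.norm.pow 2) (by fun_prop) fun t => ?_)
    exact pow_ne_zero _ (hne t)
  have hsin : ∀ θ ∈ Set.uIcc η (2 * Real.pi - η), Real.sin (θ / 2) ≠ 0 := fun θ hθ => by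
    rw [Set.uIcc_of_le (by linarith)] at hθ
    exact (sin_half_pos (hη.trans_le hθ.1) (by linarith [hθ.2])).ne'
  have hder : ∀ θ ∈ Set.uIcc η (2 * Real.pi - η),
      HasDerivAt circleParam ((1 + circleParam θ ^ 2) / 2) θ := fun θ hθ =>
    hasDerivAt_circleParam (hsin θ hθ)
  have hcont : ContinuousOn circleParam (Set.uIcc η (2 * Real.pi - η)) := fun θ hθ =>
    (hder θ hθ).continuousAt.continuousWithinAt
  have hcv := intervalIntegral.integral_comp_mul_deriv' hder
    (by fun_prop) (g := g) cg.continuousOn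
  have heq : ∫ θ in η..(2 * Real.pi - η),
      poissonKernel 0 ((z - Complex.I) / (z + Complex.I)) (circleMap 0 1 θ) *
        ‖u (cayley (circleMap 0 1 θ))‖ ^ 2 =
      ∫ θ in η..(2 * Real.pi - η), (g ∘ circleParam) θ * ((1 + circleParam θ ^ 2) / 2) := by
    refine intervalIntegral.integral_congr fun θ hθ => ?_
    simp only [Function.comp, hg]
    rw [circleMap_eq_circleParam (hsin θ hθ), cayley_inv (add_I_ne_zero (by simp)),
      poissonKernel_cayley_inv hz]
    ring
  have hle : circleParam η ≤ circleParam (2 * Real.pi - η) := by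
    have h1 : (2 * Real.pi - η) / 2 = Real.pi - η / 2 := by ring
    have h2 : 0 < Real.sin (η / 2) := sin_half_pos hη (by linarith)
    have h3 : 0 < Real.cos (η / 2) := Real.cos_pos_of_mem_Ioo ⟨by linarith, by linarith⟩
    rw [circleParam, circleParam, h1, Real.cos_pi_sub, Real.sin_pi_sub, neg_div, neg_neg]
    have := div_pos h3 h2
    linarith
  rw [heq, hcv, intervalIntegral.integral_of_le hle]
  have hgi : Integrable g := hint.const_mul _
  refine (setIntegral_le_integral hgi (ae_of_all _ fun t => ?_)).trans (le_of_eq ?_)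
  · simp only [hg, Pi.zero_apply]; positivity
  · simp only [hg]
    rw [integral_const_mul]
    field_simp

theorem integrable_div_norm_sub_sq {u : ℂ → ℂ} (hu : Continuous fun t : ℝ => u t)
    (hint : Integrable fun t : ℝ => ‖u t‖ ^ 2) {z : ℂ} (hz : 0 < z.im) :
    Integrable fun t : ℝ => ‖u t‖ ^ 2 / ‖(t : ℂ) - z‖ ^ 2 := by
  have him : ∀ t : ℝ, z.im ≤ ‖(t : ℂ) - z‖ := fun t => by
    have := Complex.abs_im_le_norm ((t : ℂ) - z)
    simp only [Complex.sub_im, Complex.ofReal_im, zero_sub, abs_neg] at this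
    exact (le_abs_self _).trans this
  refine (hint.div_const (z.im ^ 2)).mono' (Continuous.aestronglyMeasurable ?_) ?_
  · refine Continuous.div (hu.norm.pow 2) (by fun_prop) fun t => ?_
    exact pow_ne_zero _ (hz.trans_le (him t)).ne'
  · refine ae_of_all _ fun t => ?_
    rw [Real.norm_of_nonneg (by positivity)]
    gcongr
    exact him t

/-- The disc estimate is pulled back by the Cayley transform, under which the centre corresponds to
`I`; this is why the denominator must not vanish there. -/
theorem norm_sq_le_poisson_of_ne_zero_at_I {u P Q : ℂ → ℂ}
    (hu : AnalyticOnNhd ℂ u {z | 0 ≤ z.im})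
    (hQ : DifferentiableOn ℂ Q {z | 0 < z.im})
    (hP1 : ∀ z : ℂ, 0 < z.im → ‖P z‖ ≤ 1) (hQ1 : ∀ z : ℂ, 0 < z.im → ‖Q z‖ ≤ 1)
    (hQI : Q Complex.I ≠ 0) (huQ : ∀ z : ℂ, 0 < z.im → u z * Q z = P z)
    (hint : Integrable fun t : ℝ => ‖u t‖ ^ 2) {z : ℂ} (hz : 0 < z.im) :
    ‖u z‖ ^ 2 ≤ Real.exp (z.im * (-2 * Real.log ‖Q Complex.I‖)) *
      (z.im / Real.pi * ∫ t : ℝ, ‖u t‖ ^ 2 / ‖(t : ℂ) - z‖ ^ 2) := by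
  have hπ := Real.pi_pos
  set J := z.im / Real.pi * ∫ t : ℝ, ‖u t‖ ^ 2 / ‖(t : ℂ) - z‖ ^ 2 with hJ
  have hJ0 : 0 ≤ J := mul_nonneg (by positivity) (integral_nonneg fun t => by positivity)
  by_cases huz : u z = 0
  · rw [huz, norm_zero, zero_pow two_ne_zero]
    exact mul_nonneg (Real.exp_nonneg _) hJ0
  have hur : Continuous fun t : ℝ => u t :=
    hu.continuousOn.comp_continuous Complex.continuous_ofReal fun t => by simp
  have hz0 := add_I_ne_zero hz.le
  set w := (z - Complex.I) / (z + Complex.I) with hw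
  have hcw : cayley w = z := cayley_inv hz0
  have hw1 : ‖w‖ < 1 := by
    have := one_sub_norm_cayley_inv_sq hz0
    have h2 : 0 < 4 * z.im / ‖z + Complex.I‖ ^ 2 := by
      have := norm_pos_iff.2 hz0
      positivity
    rw [← this, ← hw] at h2
    nlinarith [norm_nonneg w]
  have hne1 : ∀ ζ : ℂ, ‖ζ‖ < 1 → 1 - ζ ≠ 0 := fun ζ h h0 => by
    rw [sub_eq_zero] at h0
    rw [← h0, norm_one] at h
    exact lt_irrefl _ h
  have hcim : ∀ ζ ∈ Metric.ball (0 : ℂ) 1, 0 < (cayley ζ).im := fun ζ hζ => by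
    have hζ' := mem_ball_zero_iff.1 hζ
    rw [im_cayley, poissonKernel]
    simp only [sub_zero, norm_one]
    have h1 := norm_pos_iff.2 (hne1 ζ hζ')
    have h2 : 0 < 1 ^ 2 - ‖ζ‖ ^ 2 := by nlinarith [norm_nonneg ζ]
    exact div_pos h2 (by positivity)
  have hcim' : ∀ ζ ∈ Metric.closedBall (0 : ℂ) 1, 0 ≤ (cayley ζ).im := fun ζ hζ => by
    rw [im_cayley]
    exact poissonKernel_nonneg (by simpa using hζ)
  have hcd : ∀ ζ : ℂ, 1 - ζ ≠ 0 → DifferentiableAt ℂ cayley ζ := fun ζ hζ => by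
    unfold cayley
    fun_prop (disch := exact hζ)
  have hcan : AnalyticOnNhd ℂ cayley (Metric.ball 0 1) :=
    DifferentiableOn.analyticOnNhd (fun ζ hζ =>
      (hcd ζ (hne1 ζ (mem_ball_zero_iff.1 hζ))).differentiableWithinAt) Metric.isOpen_ball
  have hopen : IsOpen {z : ℂ | 0 < z.im} := isOpen_lt continuous_const Complex.continuous_im
  have hc0 : cayley 0 = Complex.I := by simp [cayley]
  have hball : ∀ c : ℝ, 0 < c → 2 * Real.log ‖u z‖ ≤
      Real.log c - 1 + z.im * (-2 * Real.log ‖Q Complex.I‖) + J / c := by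
    intro c hc
    have h := two_mul_log_norm_le_of_quotient_ball (U := u ∘ cayley) (P := P ∘ cayley)
      (Q := Q ∘ cayley) (w := w) (c := c) (J := J)
      (hu.comp hcan fun ζ hζ => (hcim ζ hζ).le)
      (hu.continuousOn.comp (fun ζ hζ => (hcd ζ ?_).continuousAt.continuousWithinAt)
        fun ζ hζ => hcim' ζ hζ.1)
      ((hQ.analyticOnNhd hopen).comp hcan hcim)
      (fun ζ hζ => huQ _ (hcim ζ hζ)) (fun ζ hζ => hP1 _ (hcim ζ hζ))
      (fun ζ hζ => hQ1 _ (hcim ζ hζ)) (mem_ball_zero_iff.2 hw1)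
      (by simpa [hcw] using huz) (by simpa [hc0] using hQI) hc
      (fun η hη hηπ => integral_poissonKernel_arc_le hur hz
        (integrable_div_norm_sub_sq hur hint hz) hη hηπ)
    · rw [← im_cayley, hcw] at h
      simpa [hcw, hc0] using h
    · rw [sub_ne_zero]
      exact fun h => hζ.2 h.symm
  have hε : ∀ ε : ℝ, 0 < ε → ‖u z‖ ^ 2 ≤
      Real.exp (z.im * (-2 * Real.log ‖Q Complex.I‖)) * (J + ε) := by
    intro ε hε
    have hJε : 0 < J + ε := by positivity
    -- The best constant is c = J, where J / c cancels the -1; the ε covers the case J = 0.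
    have h1 := hball (J + ε) hJε
    have h2 : J / (J + ε) ≤ 1 := (div_le_one hJε).2 (by linarith)
    have hu0 : 0 < ‖u z‖ := norm_pos_iff.2 huz
    rw [← Real.log_le_log_iff (by positivity) (by positivity), Real.log_pow,
      Real.log_mul (Real.exp_pos _).ne' hJε.ne', Real.log_exp]
    push_cast
    linarith
  refine ge_of_tendsto (x := 𝓝[>] (0 : ℝ)) ?_ (eventually_nhdsWithin_of_forall hε)
  refine Tendsto.mono_left (Continuous.tendsto' (by fun_prop) _ _ ?_) nhdsWithin_le_nhds
  simp

/-- A function of bounded type in the upper half-plane that is analytic on the closed half-plane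
and square-integrable on the real line is, up to an exponential factor, dominated by the Poisson
integral of its boundary values. -/
theorem IsBoundedType.exists_norm_sq_le_poisson {u : ℂ → ℂ}
    (hu : AnalyticOnNhd ℂ u {z | 0 ≤ z.im}) (hbt : IsBoundedType u)
    (hint : Integrable fun t : ℝ => ‖u t‖ ^ 2) :
    ∃ C : ℝ, 0 ≤ C ∧ ∀ z : ℂ, 0 < z.im → ‖u z‖ ^ 2 ≤ Real.exp (C * z.im) *
      (z.im / Real.pi * ∫ t : ℝ, ‖u t‖ ^ 2 / ‖(t : ℂ) - z‖ ^ 2) := by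
  obtain ⟨-, P, Q, -, hQ, ⟨M, hM⟩, ⟨z₀, hz₀, hQz₀⟩, huQ⟩ := hbt
  set N := max M 1 with hN
  have hN0 : 0 < N := lt_max_of_lt_right one_pos
  set x₀ := z₀.re
  set y₀ := z₀.im
  -- the affine map that sends `I` to `z₀`
  set A : ℂ → ℂ := fun ζ => x₀ + y₀ * ζ with hA
  have hAim : ∀ ζ, (A ζ).im = y₀ * ζ.im := fun ζ => by simp [hA]
  have hAI : A Complex.I = z₀ := Complex.re_add_im z₀
  have hAd : Differentiable ℂ A := by simp only [hA]; fun_prop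
  have hpos : ∀ ζ : ℂ, 0 < ζ.im → 0 < (A ζ).im := fun ζ hζ => by
    rw [hAim]; exact mul_pos hz₀ hζ
  have hbd : ∀ w : ℂ, ‖w‖ ≤ M → ‖w / N‖ ≤ 1 := fun w hw => by
    rw [norm_div, Complex.norm_real, Real.norm_of_nonneg hN0.le, div_le_one hN0]
    exact hw.trans (le_max_left _ _)
  have hsub : ∀ f : ℝ → ℝ, ∫ t : ℝ, f (x₀ + y₀ * t) = y₀⁻¹ * ∫ t : ℝ, f t := fun f => by
    rw [Measure.integral_comp_mul_left (fun t => f (x₀ + t)) y₀, integral_add_left_eq_self f x₀,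
      abs_of_pos (inv_pos.2 hz₀), smul_eq_mul]
  have hQ0 : (Q ∘ A) Complex.I / N ≠ 0 := by
    simp only [Function.comp, hAI]
    exact div_ne_zero hQz₀ (by exact_mod_cast hN0.ne')
  have hint' : Integrable fun t : ℝ => ‖(u ∘ A) t‖ ^ 2 := by
    have h1 := (hint.comp_add_left x₀).comp_mul_left' hz₀.ne'
    refine h1.congr (ae_of_all _ fun t => ?_)
    simp [hA]
  have hlog : 0 ≤ -2 * Real.log ‖(Q ∘ A) Complex.I / N‖ := by
    have := Real.log_nonpos (norm_nonneg _)
      (hbd _ (hM (A Complex.I) (hpos _ (by simp))).2)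
    simp only [Function.comp]
    linarith
  refine ⟨-2 * Real.log ‖(Q ∘ A) Complex.I / N‖ / y₀, div_nonneg hlog hz₀.le, fun z hz => ?_⟩
  set ζ : ℂ := (z - x₀) / y₀ with hζ
  have hy₀ : (y₀ : ℂ) ≠ 0 := by exact_mod_cast hz₀.ne'
  have hAζ : A ζ = z := by simp only [hA, hζ]; field_simp; ring
  have hζim : ζ.im = z.im / y₀ := by
    simp [hζ, Complex.div_ofReal_im]
  have h := norm_sq_le_poisson_of_ne_zero_at_I (u := u ∘ A) (P := fun ζ => (P ∘ A) ζ / N)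
    (Q := fun ζ => (Q ∘ A) ζ / N) (z := ζ)
    (hu.comp (hAd.differentiableOn.analyticOnNhd isOpen_univ |>.mono (Set.subset_univ _))
      fun ζ hζ => by
        simp only [Set.mem_ofPred_eq, hAim] at hζ ⊢
        exact mul_nonneg hz₀.le hζ)
    ((hQ.comp hAd.differentiableOn hpos).div_const _)
    (fun ζ hζ => hbd _ (hM _ (hpos ζ hζ)).1) (fun ζ hζ => hbd _ (hM _ (hpos ζ hζ)).2)
    hQ0 (fun ζ hζ => by
      simp only [Function.comp]
      rw [← huQ _ (hpos ζ hζ)]; ring) hint' (by rw [hζim]; exact div_pos hz hz₀)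
  have hI : ∫ t : ℝ, ‖(u ∘ A) t‖ ^ 2 / ‖(t : ℂ) - ζ‖ ^ 2 =
      y₀ * ∫ t : ℝ, ‖u t‖ ^ 2 / ‖(t : ℂ) - z‖ ^ 2 := by
    have h1 := hsub fun t => ‖u t‖ ^ 2 / ‖(t : ℂ) - z‖ ^ 2
    have h2 : ∀ t : ℝ, ‖(u ∘ A) t‖ ^ 2 / ‖(t : ℂ) - ζ‖ ^ 2 =
        y₀ ^ 2 * (‖u ((x₀ + y₀ * t : ℝ) : ℂ)‖ ^ 2 / ‖((x₀ + y₀ * t : ℝ) : ℂ) - z‖ ^ 2) := by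
      intro t
      have h3 : ((x₀ + y₀ * t : ℝ) : ℂ) - z = y₀ * (t - ζ) := by
        rw [← hAζ]; simp only [hA]; push_cast; ring
      rw [h3, norm_mul, Complex.norm_real, Real.norm_of_nonneg hz₀.le, mul_pow]
      simp only [hA, Function.comp]
      push_cast
      field_simp
    simp only [h2]
    rw [integral_const_mul, h1]
    field_simp
  rw [hI, hζim] at h
  simp only [Function.comp_apply, hAζ] at h
  refine h.trans (le_of_eq ?_)
  congr 1
  · congr 1; simp only [Function.comp_apply]; ring
  · field_simp

/-! ### Mean type and exponential growth -/

/-- Nonpositive mean type means subexponential growth along the imaginary axis. -/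
theorem meanType_nonpos_iff {f : ℂ → ℂ} :
    meanType f ≤ 0 ↔ ∀ ε : ℝ, 0 < ε → ∀ᶠ y : ℝ in atTop,
      ‖f (y * Complex.I)‖ ≤ Real.exp (ε * y) := by
  have key : ∀ ε y : ℝ, 0 < y →
      (ENNReal.log ‖f (y * Complex.I)‖ₑ / (y : EReal) ≤ ε ↔
        ‖f (y * Complex.I)‖ ≤ Real.exp (ε * y)) := by
    intro ε y hy
    rw [EReal.div_le_iff_le_mul (by exact_mod_cast hy) (EReal.coe_ne_top _), ← EReal.coe_mul,
      ← Real.log_exp (y * ε), ← ENNReal.log_ofReal_of_pos (Real.exp_pos _),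
      ENNReal.log_le_log_iff, ← ofReal_norm, ENNReal.ofReal_le_ofReal_iff (Real.exp_nonneg _),
      mul_comm y]
  rw [meanType, limsup_le_iff']
  constructor
  · intro h ε hε
    filter_upwards [h ε (by exact_mod_cast hε), eventually_gt_atTop 0] with y hy hy0
    exact (key ε y hy0).1 hy
  · intro h b hb
    obtain ⟨ε, hε, hεb⟩ := EReal.lt_iff_exists_real_btwn.1 hb
    filter_upwards [h ε (by exact_mod_cast hε), eventually_gt_atTop 0] with y hy hy0
    exact ((key ε y hy0).2 hy).trans hεb.le

/-- A Phragmén-Lindelöf principle: a function of exponential type in the upper half-plane, whose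
growth on the imaginary axis is subexponential, is bounded on smaller half-planes. -/
theorem norm_le_of_exponential_type {u : ℂ → ℂ} (hu : AnalyticOnNhd ℂ u {z | 0 ≤ z.im}) {K C : ℝ}
    (hC : 0 ≤ C) (hb : ∀ z : ℂ, 1 ≤ z.im → ‖u z‖ ≤ K * Real.exp (C * z.im))
    (hmt : ∀ ε : ℝ, 0 < ε → ∀ᶠ y : ℝ in atTop, ‖u (y * Complex.I)‖ ≤ Real.exp (ε * y))
    {z : ℂ} (hz : 1 ≤ z.im) : ‖u z‖ ≤ K * Real.exp C := by
  have hK : 0 ≤ K := by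
    have h1 := (norm_nonneg _).trans (hb Complex.I (by simp))
    exact nonneg_of_mul_nonneg_left h1 (Real.exp_pos _)
  -- `A` carries the right half-plane onto Im z > 1 and the positive reals into the imaginary axis.
  set A : ℂ → ℂ := fun ζ => Complex.I * ζ + Complex.I with hA
  have hAim : ∀ ζ, (A ζ).im = ζ.re + 1 := fun ζ => by simp [hA]
  have hε : ∀ ε : ℝ, 0 < ε → ‖Complex.exp (-ε * (z / Complex.I)) * u z‖ ≤ K * Real.exp C := by
    intro ε hε
    -- The exponential has modulus at most one on the closed right half-plane, so it keeps the bound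
    -- on the boundary line, and it turns subexponential growth on the real ray into boundedness.
    -- Afterwards ε → 0.
    set G : ℂ → ℂ := fun ζ => Complex.exp (-ε * (ζ + 1)) * u (A ζ) with hG
    have hGn : ∀ ζ, ‖G ζ‖ = Real.exp (-ε * (ζ.re + 1)) * ‖u (A ζ)‖ := fun ζ => by
      simp [hG, Complex.norm_exp]
    have hexp1 : ∀ x : ℝ, 0 ≤ x → Real.exp (-ε * (x + 1)) ≤ 1 := fun x hx => by
      rw [Real.exp_le_one_iff]; nlinarith
    have hzA : A (z / Complex.I - 1) = z := by
      simp only [hA]; field_simp; ring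
    have := PhragmenLindelof.right_half_plane_of_bounded_on_real (f := G) (C := K * Real.exp C)
      (z := z / Complex.I - 1) ?_ ?_ ?_ ?_ ?_
    · simpa only [hG, sub_add_cancel, hzA] using this
    · refine DifferentiableOn.diffContOnCl fun ζ hζ => ?_
      rw [Complex.closure_setOfPred_lt_re] at hζ
      have h1 : DifferentiableAt ℂ u (A ζ) := (hu (A ζ) (by
        have h0 : 0 ≤ ζ.re := hζ
        simp only [Set.mem_ofPred_eq, hAim]; linarith)).differentiableAt
      have h2 : DifferentiableAt ℂ A ζ := by simp only [hA]; fun_prop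
      have h3 : DifferentiableAt ℂ (fun ζ => u (A ζ)) ζ := h1.comp ζ h2
      exact DifferentiableAt.differentiableWithinAt (by fun_prop)
    · refine ⟨1, by norm_num, C, Asymptotics.IsBigO.of_bound (K * Real.exp C) ?_⟩
      refine eventually_inf_principal.2 (Eventually.of_forall fun ζ (hζ : 0 < ζ.re) => ?_)
      rw [hGn, Real.norm_of_nonneg (Real.exp_nonneg _), Real.rpow_one]
      calc Real.exp (-ε * (ζ.re + 1)) * ‖u (A ζ)‖ ≤ 1 * (K * Real.exp (C * (ζ.re + 1))) := by
            refine mul_le_mul (hexp1 _ hζ.le) ?_ (norm_nonneg _) zero_le_one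
            have := hb (A ζ) (by rw [hAim]; linarith)
            rwa [hAim] at this
        _ = K * Real.exp C * Real.exp (C * ζ.re) := by
            rw [mul_add, mul_one, Real.exp_add]; ring
        _ ≤ K * Real.exp C * Real.exp (C * ‖ζ‖) := by
            gcongr
            exact Complex.re_le_norm ζ
    · refine ⟨1, ?_⟩
      have h1 := (tendsto_atTop_add_const_right atTop (1 : ℝ) tendsto_id).eventually (hmt ε hε)
      simp only [eventually_map]
      filter_upwards [h1] with x hx
      have hAx : A x = ((x + 1 : ℝ) : ℂ) * Complex.I := by simp only [hA]; push_cast; ring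
      rw [hGn, hAx, Complex.ofReal_re]
      calc _ ≤ Real.exp (-ε * (x + 1)) * Real.exp (ε * (x + 1)) := by gcongr; exact hx
        _ = 1 := by rw [← Real.exp_add]; simp
    · intro x
      rw [hGn]
      have h1 := hb (A (x * Complex.I)) (by simp [hAim])
      simp only [hAim, Complex.mul_re, Complex.ofReal_re, Complex.I_re, mul_zero,
        Complex.ofReal_im, Complex.I_im, sub_zero, zero_add, mul_one] at h1 ⊢
      calc _ ≤ 1 * (K * Real.exp C) := by
            refine mul_le_mul ?_ h1 (norm_nonneg _) zero_le_one
            rw [Real.exp_le_one_iff]; linarith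
        _ = _ := one_mul _
    · simpa [Complex.div_I] using hz
  have hlim : Tendsto (fun ε : ℝ => ‖Complex.exp (-ε * (z / Complex.I)) * u z‖) (𝓝[>] 0)
      (𝓝 ‖u z‖) := by
    refine Tendsto.mono_left (Continuous.tendsto' (by fun_prop) _ _ ?_) nhdsWithin_le_nhds
    simp
  exact le_of_tendsto hlim (eventually_nhdsWithin_of_forall hε)

/-! ### Hardy classes and Cauchy's theorem -/

/-- Functions analytic on the closed upper half-plane, bounded away from the real line, with
bounded `L^p`-means on the horizontal lines near the real line. -/
structure IsHardy (p : ℕ) (u : ℂ → ℂ) : Prop where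
  analytic : AnalyticOnNhd ℂ u {z | 0 ≤ z.im}
  bounded : ∃ B : ℝ, ∀ z : ℂ, 1 ≤ z.im → ‖u z‖ ≤ B
  mean : ∃ M : ℝ≥0∞, M < ∞ ∧ ∀ y ∈ Set.Icc (0 : ℝ) 1, ∫⁻ x : ℝ, ‖u (x + y * Complex.I)‖ₑ ^ p ≤ M

/-- By Tonelli, since the Poisson kernel in the variable x is the Cauchy probability density centred
at t. -/
theorem lintegral_poisson {u : ℂ → ℂ} (hu : Continuous fun t : ℝ => u t) {y : ℝ} (hy : 0 < y)
    (hint : Integrable fun t : ℝ => ‖u t‖ ^ 2) :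
    ∫⁻ x : ℝ, ENNReal.ofReal (y / Real.pi * ∫ t : ℝ, ‖u t‖ ^ 2 / ‖(t : ℂ) - (x + y * Complex.I)‖ ^ 2) =
      ∫⁻ t : ℝ, ‖u t‖ₑ ^ 2 := by
  set γ : NNReal := ⟨y, hy.le⟩ with hγ
  have hγ0 : γ ≠ 0 := by
    intro h
    have := congrArg NNReal.toReal h
    exact hy.ne' this
  have hγy : (γ : ℝ) = y := rfl
  have hnorm : ∀ x t : ℝ, ‖(t : ℂ) - (x + y * Complex.I)‖ ^ 2 = (x - t) ^ 2 + y ^ 2 := by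
    intro x t
    rw [Complex.sq_norm, Complex.normSq_apply]; simp; ring
  have h1 : ∀ x : ℝ, ENNReal.ofReal (y / Real.pi * ∫ t : ℝ,
      ‖u t‖ ^ 2 / ‖(t : ℂ) - (x + y * Complex.I)‖ ^ 2) =
      ∫⁻ t : ℝ, ‖u t‖ₑ ^ 2 * ProbabilityTheory.cauchyPDF t γ x := by
    intro x
    rw [← integral_const_mul, ofReal_integral_eq_lintegral_ofReal]
    · refine lintegral_congr fun t => ?_
      rw [← ofReal_norm, ← ENNReal.ofReal_pow (norm_nonneg _), ProbabilityTheory.cauchyPDF_def,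
        ← ENNReal.ofReal_mul (by positivity), ProbabilityTheory.cauchyPDFReal_def, hnorm]
      congr 1
      rw [hγy]
      have : (x - t) ^ 2 + y ^ 2 ≠ 0 := by positivity
      field_simp
    · exact (integrable_div_norm_sub_sq hu hint (by simpa using hy)).const_mul _
    · exact ae_of_all _ fun t => by have := Real.pi_pos; simp only [Pi.zero_apply]; positivity
  simp only [h1]
  rw [lintegral_lintegral_swap]
  · refine lintegral_congr fun t => ?_
    rw [lintegral_const_mul _ (ProbabilityTheory.measurable_cauchyPDF t γ),
      ProbabilityTheory.lintegral_cauchyPDF_eq_one t hγ0, mul_one]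
  · have h2 : Measurable fun p : ℝ × ℝ => ‖u p.2‖ₑ ^ 2 :=
      (hu.enorm.measurable.comp measurable_snd).pow_const 2
    have h3 : Measurable fun p : ℝ × ℝ => ProbabilityTheory.cauchyPDF p.2 γ p.1 := by
      simp only [ProbabilityTheory.cauchyPDF_def, ProbabilityTheory.cauchyPDFReal_def]
      fun_prop
    exact (h2.mul h3).aemeasurable

/-- A function of bounded type and nonpositive mean type in the upper half-plane, analytic on the
closed half-plane and square-integrable on the real line, belongs to the Hardy space. -/
theorem IsBoundedType.isHardy {u : ℂ → ℂ} (hbt : IsBoundedType u)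
    (hu : AnalyticOnNhd ℂ u {z | 0 ≤ z.im}) (hmt : meanType u ≤ 0)
    (hint : Integrable fun t : ℝ => ‖u t‖ ^ 2) : IsHardy 2 u := by
  have hπ := Real.pi_gt_three
  obtain ⟨C, hC, hmaj⟩ := hbt.exists_norm_sq_le_poisson hu hint
  have hur : Continuous fun t : ℝ => u t :=
    hu.continuousOn.comp_continuous Complex.continuous_ofReal fun t => by simp
  set N := ∫ t : ℝ, ‖u t‖ ^ 2 with hN
  have hN0 : 0 ≤ N := integral_nonneg fun t => by positivity
  -- For Im z ≥ 1 the Poisson integral is at most N / (π Im z) ≤ N, so `u` has exponential type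
  -- there and mean type removes the growth. For 0 < Im z ≤ 1 the exponential costs only the factor
  -- exp C, and the Poisson integral preserves mass.
  refine ⟨hu, ⟨√N * Real.exp C, fun z hz =>
    norm_le_of_exponential_type hu hC (fun z hz => ?_) (meanType_nonpos_iff.1 hmt) hz⟩,
    ENNReal.ofReal (Real.exp C) * ∫⁻ t : ℝ, ‖u t‖ₑ ^ 2, ?_, ?_⟩
  · have hz0 : 0 < z.im := by linarith
    have him : ∀ t : ℝ, z.im ≤ ‖(t : ℂ) - z‖ := fun t => by
      have := Complex.abs_im_le_norm ((t : ℂ) - z)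
      simp only [Complex.sub_im, Complex.ofReal_im, zero_sub, abs_neg] at this
      exact (le_abs_self _).trans this
    have h1 : ∫ t : ℝ, ‖u t‖ ^ 2 / ‖(t : ℂ) - z‖ ^ 2 ≤ N / z.im ^ 2 := by
      rw [hN, ← integral_div]
      refine integral_mono (integrable_div_norm_sub_sq hur hint hz0) (hint.div_const _) fun t => ?_
      dsimp only
      gcongr
      exact him t
    have h2 : z.im / Real.pi * ∫ t : ℝ, ‖u t‖ ^ 2 / ‖(t : ℂ) - z‖ ^ 2 ≤ N := by
      calc _ ≤ z.im / Real.pi * (N / z.im ^ 2) := by gcongr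
        _ = N / (Real.pi * z.im) := by field_simp
        _ ≤ N := div_le_self hN0 (by nlinarith)
    refine le_of_sq_le_sq ((hmaj z hz0).trans ?_) (by positivity)
    rw [mul_pow, Real.sq_sqrt hN0, mul_comm N]
    refine mul_le_mul ?_ h2 (mul_nonneg (by positivity)
      (integral_nonneg fun t => by positivity)) (by positivity)
    refine le_self_pow₀ ?_ two_ne_zero
    rw [Real.one_le_exp_iff]; positivity
  · refine ENNReal.mul_lt_top ENNReal.ofReal_lt_top ?_
    have := hint.2
    rw [HasFiniteIntegral] at this
    simpa [enorm_pow] using this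
  · rintro y ⟨hy0, hy1⟩
    rcases hy0.eq_or_lt with rfl | hy
    · simp only [Complex.ofReal_zero, zero_mul, add_zero]
      refine le_mul_of_one_le_left zero_le ?_
      rw [ENNReal.one_le_ofReal, Real.one_le_exp_iff]
      exact hC
    · rw [← lintegral_poisson hur hy hint, ← lintegral_const_mul' _ _ ENNReal.ofReal_ne_top]
      refine lintegral_mono fun x => ?_
      have h1 := hmaj (x + y * Complex.I) (by simpa using hy)
      have him : ((x : ℂ) + y * Complex.I).im = y := by simp
      rw [him] at h1
      rw [← ENNReal.ofReal_mul (Real.exp_nonneg _), ← ofReal_norm,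
        ← ENNReal.ofReal_pow (norm_nonneg _)]
      refine ENNReal.ofReal_le_ofReal (h1.trans ?_)
      refine mul_le_mul_of_nonneg_right ?_ (mul_nonneg (by positivity)
        (integral_nonneg fun t => by positivity))
      rw [Real.exp_le_exp]
      nlinarith

/-- Clamping the height at zero gives a function continuous on the whole plane, so that joint
measurability for Tonelli is immediate. -/
theorem AnalyticOnNhd.continuous_clamp {p : ℂ → ℂ} (hp : AnalyticOnNhd ℂ p {z | 0 ≤ z.im}) :
    Continuous fun q : ℝ × ℝ => p (q.1 + ((max q.2 0 : ℝ) : ℂ) * Complex.I) :=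
  hp.continuousOn.comp_continuous (by fun_prop) fun q => by simp

theorem AnalyticOnNhd.continuous_horizontal {p : ℂ → ℂ} (hp : AnalyticOnNhd ℂ p {z | 0 ≤ z.im})
    {y : ℝ} (hy : 0 ≤ y) : Continuous fun x : ℝ => p (x + y * Complex.I) :=
  hp.continuousOn.comp_continuous (by fun_prop) fun x => by simpa

theorem AnalyticOnNhd.continuous_real {p : ℂ → ℂ} (hp : AnalyticOnNhd ℂ p {z | 0 ≤ z.im}) :
    Continuous fun x : ℝ => p x :=
  hp.continuousOn.comp_continuous (by fun_prop) fun x => by simp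

theorem IsHardy.integrable_norm_pow {k : ℕ} {p : ℂ → ℂ} (hp : IsHardy k p) :
    Integrable fun t : ℝ => ‖p t‖ ^ k := by
  obtain ⟨M, hM, hle⟩ := hp.mean
  refine ⟨(hp.analytic.continuous_real.norm.pow k).aestronglyMeasurable, ?_⟩
  have := hle 0 ⟨le_rfl, zero_le_one⟩
  simp only [Complex.ofReal_zero, zero_mul, add_zero] at this
  rw [HasFiniteIntegral]
  simpa [enorm_pow] using this.trans_lt hM

theorem IsHardy.integrable {p : ℂ → ℂ} (hp : IsHardy 1 p) : Integrable fun t : ℝ => p t := by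
  have := hp.integrable_norm_pow
  simp only [pow_one] at this
  exact (integrable_norm_iff hp.analytic.continuous_real.aestronglyMeasurable).1 this

/-- The integrals of a Hardy function over vertical segments are small for suitable abscissas. -/
theorem IsHardy.frequently_vertical_lt {p : ℂ → ℂ} (hp : IsHardy 1 p) {η : ℝ≥0∞} (hη : 0 < η) :
    ∃ᶠ R : ℝ in atTop,
      (∫⁻ y in Set.Ioc (0 : ℝ) 1, ‖p (R + y * Complex.I)‖ₑ) < η ∧
      (∫⁻ y in Set.Ioc (0 : ℝ) 1, ‖p ((-R : ℝ) + y * Complex.I)‖ₑ) < η := by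
  obtain ⟨M, hM, hle⟩ := hp.mean
  simp only [pow_one] at hle
  set ℓ : ℝ → ℝ≥0∞ := fun x => ∫⁻ y in Set.Ioc (0 : ℝ) 1, ‖p (x + y * Complex.I)‖ₑ with hℓ
  set P : ℝ → ℝ → ℂ := fun x y => p (x + ((max y 0 : ℝ) : ℂ) * Complex.I) with hP
  have hPc : Continuous (Function.uncurry P) := hp.analytic.continuous_clamp
  have hℓP : ∀ x, ℓ x = ∫⁻ y in Set.Ioc (0 : ℝ) 1, ‖P x y‖ₑ := fun x => by
    refine setLIntegral_congr_fun measurableSet_Ioc fun y hy => ?_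
    simp only [hP, max_eq_left hy.1.le]
  have hℓm : Measurable ℓ := by
    have : ℓ = fun x => ∫⁻ y in Set.Ioc (0 : ℝ) 1, ‖P x y‖ₑ := funext hℓP
    rw [this]
    exact Measurable.lintegral_prod_right' (f := fun q : ℝ × ℝ => ‖P q.1 q.2‖ₑ)
      hPc.enorm.measurable
  have hint : ∫⁻ x, ℓ x ≤ M := by
    simp only [hℓP]
    rw [lintegral_lintegral_swap hPc.enorm.measurable.aemeasurable]
    calc ∫⁻ y in Set.Ioc (0 : ℝ) 1, ∫⁻ x, ‖P x y‖ₑ ≤ ∫⁻ y in Set.Ioc (0 : ℝ) 1, M := by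
          refine setLIntegral_mono' measurableSet_Ioc fun y hy => ?_
          have := hle y ⟨hy.1.le, hy.2⟩
          simpa only [hP, max_eq_left hy.1.le] using this
      _ = M := by simp
  have hint' : ∫⁻ x, (ℓ x + ℓ (-x)) < ∞ := by
    rw [lintegral_add_left hℓm, lintegral_neg_eq_self]
    exact ENNReal.add_lt_top.2 ⟨hint.trans_lt hM, hint.trans_lt hM⟩
  -- Otherwise ℓ(x) + ℓ(-x) ≥ η for all large x, against the finiteness of its integral.
  by_contra hcon
  rw [not_frequently, eventually_atTop] at hcon
  obtain ⟨X, hX⟩ := hcon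
  have hge : ∀ x ∈ Set.Ici X, η ≤ ℓ x + ℓ (-x) := fun x hx => by
    by_contra hlt
    rw [not_le] at hlt
    exact hX x hx ⟨(le_self_add).trans_lt hlt, (le_add_self).trans_lt hlt⟩
  have htop : ∫⁻ x in Set.Ici X, η ≤ ∫⁻ x, (ℓ x + ℓ (-x)) :=
    (setLIntegral_mono' measurableSet_Ici hge).trans (setLIntegral_le_lintegral _ _)
  rw [setLIntegral_const, Real.volume_Ici, ENNReal.mul_top hη.ne'] at htop
  exact absurd hint' (not_lt.2 htop)

/-- The contour estimate for a Hardy function with quadratic decay. -/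
theorem norm_integral_le_of_rect {q : ℂ → ℂ} (hq : AnalyticOnNhd ℂ q {z | 0 ≤ z.im})
    {D η R : ℝ} (hR : 1 ≤ R) (hη : 0 ≤ η)
    (hD : ∀ z : ℂ, 1 ≤ z.im → R ≤ ‖z‖ → (|z.re| = R ∨ z.im = R) → ‖q z‖ ≤ D / R ^ 2)
    (h1 : (∫⁻ y in Set.Ioc (0 : ℝ) 1, ‖q (R + y * Complex.I)‖ₑ) ≤ ENNReal.ofReal η)
    (h2 : (∫⁻ y in Set.Ioc (0 : ℝ) 1, ‖q ((-R : ℝ) + y * Complex.I)‖ₑ) ≤ ENNReal.ofReal η) :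
    ‖∫ x in (-R)..R, q x‖ ≤ 2 * η + 4 * D / R := by
  have hR0 : 0 < R := by linarith
  have hrect := Complex.integral_boundary_rect_eq_zero_of_differentiableOn q ((-R : ℝ) : ℂ)
    (R + R * Complex.I) (fun z hz => by
      have h0 : z.im ∈ Set.uIcc 0 R := by simpa using hz.2
      rw [Set.uIcc_of_le hR0.le] at h0
      exact (hq z h0.1).differentiableAt.differentiableWithinAt)
  simp only [Complex.ofReal_re, Complex.ofReal_im, Complex.add_re, Complex.mul_re, Complex.I_re,
    Complex.I_im, Complex.add_im, Complex.mul_im, mul_zero, mul_one, zero_mul, sub_zero, add_zero,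
    zero_add, Complex.ofReal_zero, smul_eq_mul] at hrect
  -- The contour is the rectangle [-R, R] × [0, R]. The top contributes 2D/R; each vertical side
  -- contributes η below height one and at most D/R above it.
  have htop : ‖∫ x in (-R)..R, q (x + R * Complex.I)‖ ≤ 2 * (D / R) := by
    have := intervalIntegral.norm_integral_le_of_norm_le_const (a := -R) (b := R) (C := D / R ^ 2)
      (f := fun x : ℝ => q (x + R * Complex.I)) (fun x _ => by
        refine hD _ (by simpa using hR) ?_ (Or.inr (by simp))
        have := Complex.abs_im_le_norm ((x : ℂ) + R * Complex.I)
        simp only [Complex.add_im, Complex.ofReal_im, Complex.mul_im, Complex.ofReal_re,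
          Complex.I_im, Complex.I_re, mul_one, mul_zero, add_zero, zero_add] at this
        exact (le_abs_self R).trans this)
    refine this.trans (le_of_eq ?_)
    rw [sub_neg_eq_add, abs_of_pos (by linarith)]
    field_simp
    ring
  have hside : ∀ a : ℝ, |a| = R →
      (∫⁻ y in Set.Ioc (0 : ℝ) 1, ‖q (a + y * Complex.I)‖ₑ) ≤ ENNReal.ofReal η →
      ‖∫ y in (0 : ℝ)..R, q (a + y * Complex.I)‖ ≤ η + D / R := by
    intro a ha hle
    have hc : ContinuousOn (fun y : ℝ => q (a + y * Complex.I)) (Set.Ici 0) :=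
      hq.continuousOn.comp (by fun_prop) fun y hy => by simpa using hy
    have hi : ∀ b c : ℝ, 0 ≤ b → 0 ≤ c →
        IntervalIntegrable (fun y : ℝ => q (a + y * Complex.I)) volume b c := fun b c hb hc' =>
      (hc.mono fun y hy => (le_min hb hc').trans hy.1).intervalIntegrable
    rw [← intervalIntegral.integral_add_adjacent_intervals (hi 0 1 le_rfl zero_le_one)
      (hi 1 R zero_le_one hR0.le)]
    refine (norm_add_le _ _).trans (add_le_add ?_ ?_)
    · rw [intervalIntegral.integral_of_le zero_le_one]
      have := (enorm_integral_le_lintegral_enorm _).trans hle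
      rwa [← ofReal_norm, ENNReal.ofReal_le_ofReal_iff hη] at this
    · have := intervalIntegral.norm_integral_le_of_norm_le_const (a := 1) (b := R)
        (C := D / R ^ 2) (f := fun y : ℝ => q (a + y * Complex.I)) (fun y hy => by
          rw [Set.uIoc_of_le hR] at hy
          refine hD _ (by simpa using hy.1.le) ?_ (Or.inl (by simpa using ha))
          have := Complex.abs_re_le_norm ((a : ℂ) + y * Complex.I)
          simp only [Complex.add_re, Complex.ofReal_re, Complex.mul_re, Complex.ofReal_im,
            Complex.I_im, Complex.I_re, mul_one, mul_zero, sub_zero, add_zero] at this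
          exact ha ▸ this)
      refine this.trans ?_
      have hD0 : 0 ≤ D / R ^ 2 := (norm_nonneg _).trans
        (hD (R + R * Complex.I) (by simpa using hR) (by
          have := Complex.abs_re_le_norm ((R : ℂ) + R * Complex.I)
          simp only [Complex.add_re, Complex.ofReal_re, Complex.mul_re, Complex.ofReal_im,
            Complex.I_im, Complex.I_re, mul_one, mul_zero, sub_zero, add_zero] at this
          exact (le_abs_self R).trans this) (Or.inr (by simp)))
      rw [abs_of_nonneg (by linarith)]
      calc D / R ^ 2 * (R - 1) ≤ D / R ^ 2 * R := by gcongr; linarith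
        _ = D / R := by field_simp
  have hr := hside R (abs_of_pos hR0) h1
  have hl := hside (-R) (by rw [abs_neg, abs_of_pos hR0]) h2
  have hsum : ∫ x in (-R)..R, q x = (∫ x in (-R)..R, q (x + R * Complex.I)) -
      Complex.I * (∫ y in (0 : ℝ)..R, q (R + y * Complex.I)) +
      Complex.I * ∫ y in (0 : ℝ)..R, q ((-R : ℝ) + y * Complex.I) := by
    linear_combination hrect
  rw [hsum]
  refine (norm_add_le _ _).trans ?_
  refine (add_le_add_left (norm_sub_le _ _) _).trans ?_
  rw [norm_mul, norm_mul, Complex.norm_I, one_mul, one_mul]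
  have : 4 * D / R = 4 * (D / R) := by ring
  linarith

/-- The integral of a function of the Hardy space `H^1` over the real line vanishes. -/
theorem IsHardy.integral_eq_zero {p : ℂ → ℂ} (hp : IsHardy 1 p) : ∫ t : ℝ, p t = 0 := by
  obtain ⟨B, hB⟩ := hp.bounded
  have hB0 : 0 ≤ B := (norm_nonneg _).trans (hB Complex.I (by simp))
  have hpi := hp.integrable
  have hden : ∀ (ε : ℝ) (z : ℂ), 0 ≤ ε → 0 ≤ z.im → 1 ≤ ‖Complex.I + ε * z‖ := by
    intro ε z hε hz
    have := Complex.abs_im_le_norm (Complex.I + ε * z)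
    simp only [Complex.add_im, Complex.I_im, Complex.mul_im, Complex.ofReal_re, Complex.ofReal_im,
      zero_mul, add_zero] at this
    have h2 : 0 ≤ ε * z.im := mul_nonneg hε hz
    rw [abs_of_nonneg (by linarith)] at this
    linarith
  have hne : ∀ (ε : ℝ) (z : ℂ), 0 ≤ ε → 0 ≤ z.im → Complex.I + ε * z ≠ 0 := fun ε z hε hz h => by
    have := hden ε z hε hz
    rw [h, norm_zero] at this
    linarith
  -- On the closed half-plane the regularising factor has modulus at most one, and for ε > 0 it
  -- decays quadratically. It tends to 1 as ε → 0, so dominated convergence recovers `p`.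
  set q : ℝ → ℂ → ℂ := fun ε z => (Complex.I / (Complex.I + ε * z)) ^ 2 * p z with hq
  have hqn : ∀ ε z, ‖q ε z‖ = ‖p z‖ / ‖Complex.I + ε * z‖ ^ 2 := fun ε z => by
    simp only [hq, norm_mul, norm_pow, norm_div, Complex.norm_I]
    ring
  have hqle : ∀ (ε : ℝ) (z : ℂ), 0 ≤ ε → 0 ≤ z.im → ‖q ε z‖ ≤ ‖p z‖ := fun ε z hε hz => by
    rw [hqn]
    exact div_le_self (norm_nonneg _) (one_le_pow₀ (hden ε z hε hz))
  have hqa : ∀ ε : ℝ, 0 ≤ ε → AnalyticOnNhd ℂ (q ε) {z | 0 ≤ z.im} := by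
    intro ε hε z hz
    have h1 : AnalyticAt ℂ (fun z : ℂ => Complex.I + ε * z) z := by fun_prop
    exact ((analyticAt_const.div h1 (hne ε z hε hz)).pow 2).mul (hp.analytic z hz)
  have hqi : ∀ ε : ℝ, 0 ≤ ε → Integrable fun t : ℝ => q ε t := fun ε hε =>
    hpi.mono (hqa ε hε).continuous_real.aestronglyMeasurable
      (ae_of_all _ fun t => hqle ε t hε (by simp))
  have hzero : ∀ ε : ℝ, 0 < ε → ∫ t : ℝ, q ε t = 0 := by
    intro ε hε
    have hlim : Tendsto (fun R : ℝ => ‖∫ x in (-R)..R, q ε x‖) atTop (𝓝 ‖∫ t : ℝ, q ε t‖) :=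
      (intervalIntegral_tendsto_integral (hqi ε hε.le) tendsto_neg_atTop_atBot tendsto_id).norm
    have hbound : ∀ η : ℝ, 0 < η → ‖∫ t : ℝ, q ε t‖ ≤ 2 * η + 0 := by
      intro η hη
      have hlim2 : Tendsto (fun R : ℝ => 2 * η + 4 * (B / ε ^ 2) / R) atTop (𝓝 (2 * η + 0)) :=
        tendsto_const_nhds.add (tendsto_const_nhds.div_atTop tendsto_id)
      refine le_of_tendsto_of_tendsto_of_frequently hlim hlim2 ?_
      refine ((hp.frequently_vertical_lt (η := ENNReal.ofReal η)
        (ENNReal.ofReal_pos.2 hη)).and_eventually (eventually_ge_atTop 1)).mono ?_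
      rintro R ⟨⟨h1, h2⟩, hR⟩
      have hR0 : 0 < R := by linarith
      refine norm_integral_le_of_rect (hqa ε hε.le) hR hη.le ?_ ?_ ?_
      · intro z hz _ hor
        have h3 : ε * R ≤ ‖Complex.I + ε * z‖ := by
          rcases hor with h | h
          · have := Complex.abs_re_le_norm (Complex.I + ε * z)
            simp only [Complex.add_re, Complex.I_re, Complex.mul_re, Complex.ofReal_re,
              Complex.ofReal_im, zero_mul, sub_zero, zero_add, abs_mul, h, abs_of_pos hε] at this
            exact this
          · have := Complex.abs_im_le_norm (Complex.I + ε * z)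
            simp only [Complex.add_im, Complex.I_im, Complex.mul_im, Complex.ofReal_re,
              Complex.ofReal_im, zero_mul, add_zero, h] at this
            have h2 : 0 ≤ ε * R := by positivity
            rw [abs_of_nonneg (by linarith)] at this
            linarith
        rw [hqn, div_div, ← mul_pow]
        have := hB z hz
        gcongr
      · refine le_trans ?_ h1.le
        exact setLIntegral_mono' measurableSet_Ioc fun y hy =>
          enorm_le_iff_norm_le.2 (hqle ε _ hε.le (by simpa using hy.1.le))
      · refine le_trans ?_ h2.le
        exact setLIntegral_mono' measurableSet_Ioc fun y hy =>
          enorm_le_iff_norm_le.2 (hqle ε _ hε.le (by simpa using hy.1.le))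
    have hle : ‖∫ t : ℝ, q ε t‖ ≤ 0 := by
      refine ge_of_tendsto (x := 𝓝[>] (0 : ℝ)) ?_ (eventually_nhdsWithin_of_forall hbound)
      refine Tendsto.mono_left (Continuous.tendsto' (by fun_prop) _ _ ?_) nhdsWithin_le_nhds
      simp
    exact norm_le_zero_iff.1 hle
  have hlim : Tendsto (fun ε : ℝ => ∫ t : ℝ, q ε t) (𝓝[>] 0) (𝓝 (∫ t : ℝ, p t)) := by
    refine tendsto_integral_filter_of_dominated_convergence (fun t => ‖p t‖) ?_ ?_ hpi.norm ?_
    · exact eventually_nhdsWithin_of_forall fun ε hε =>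
        (hqa ε (le_of_lt hε)).continuous_real.aestronglyMeasurable
    · exact eventually_nhdsWithin_of_forall fun ε hε =>
        ae_of_all _ fun t => hqle ε t (le_of_lt hε) (by simp)
    · refine ae_of_all _ fun t => ?_
      have hc : ContinuousAt (fun ε : ℝ => q ε t) 0 := by
        simp only [hq]
        have : ContinuousAt (fun ε : ℝ => Complex.I / (Complex.I + ε * t)) 0 :=
          ContinuousAt.div (by fun_prop) (by fun_prop) (by simp)
        fun_prop
      refine (hc.tendsto.mono_left nhdsWithin_le_nhds).congr' EventuallyEq.rfl |>.trans ?_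
      simp [hq]
  refine tendsto_nhds_unique hlim ?_
  exact tendsto_const_nhds.congr' (eventually_nhdsWithin_of_forall fun ε hε => (hzero ε hε).symm)

/-! ### Products, divided differences and Cauchy's formula -/

theorem mul_le_sq_add_sq {a b : ℝ} : a * b ≤ a ^ 2 + b ^ 2 := by
  nlinarith [sq_nonneg (a - b), sq_nonneg a, sq_nonneg b]

theorem IsHardy.mul {a b : ℂ → ℂ} (ha : IsHardy 2 a) (hb : IsHardy 2 b) :
    IsHardy 1 fun z => a z * b z := by
  obtain ⟨A, hA⟩ := ha.bounded
  obtain ⟨B, hB⟩ := hb.bounded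
  obtain ⟨M, hM, hM'⟩ := ha.mean
  obtain ⟨N, hN, hN'⟩ := hb.mean
  refine ⟨fun z hz => (ha.analytic z hz).mul (hb.analytic z hz), ⟨A * B, fun z hz => ?_⟩,
    M + N, ENNReal.add_lt_top.2 ⟨hM, hN⟩, fun y hy => ?_⟩
  · rw [norm_mul]
    exact mul_le_mul (hA z hz) (hB z hz) (norm_nonneg _) ((norm_nonneg _).trans (hA z hz))
  · refine le_trans ?_ (add_le_add (hM' y hy) (hN' y hy))
    rw [← lintegral_add_left
      ((ha.analytic.continuous_horizontal hy.1).enorm.measurable.pow_const 2)]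
    refine lintegral_mono fun x => ?_
    simp only [pow_one, ← ofReal_norm]
    rw [← ENNReal.ofReal_pow (norm_nonneg _), ← ENNReal.ofReal_pow (norm_nonneg _),
      ← ENNReal.ofReal_add (by positivity) (by positivity), norm_mul]
    exact ENNReal.ofReal_le_ofReal mul_le_sq_add_sq

theorem IsHardy.sub {a b : ℂ → ℂ} (ha : IsHardy 2 a) (hb : IsHardy 2 b) :
    IsHardy 2 fun z => a z - b z := by
  obtain ⟨A, hA⟩ := ha.bounded
  obtain ⟨B, hB⟩ := hb.bounded
  obtain ⟨M, hM, hM'⟩ := ha.mean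
  obtain ⟨N, hN, hN'⟩ := hb.mean
  refine ⟨fun z hz => (ha.analytic z hz).sub (hb.analytic z hz), ⟨A + B, fun z hz => ?_⟩,
    2 * (M + N), ENNReal.mul_lt_top (by simp) (ENNReal.add_lt_top.2 ⟨hM, hN⟩), fun y hy => ?_⟩
  · exact (norm_sub_le _ _).trans (add_le_add (hA z hz) (hB z hz))
  · refine le_trans ?_ (mul_le_mul_right (add_le_add (hM' y hy) (hN' y hy)) 2)
    rw [← lintegral_add_left
      ((ha.analytic.continuous_horizontal hy.1).enorm.measurable.pow_const 2),
      ← lintegral_const_mul' _ _ (by simp)]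
    refine lintegral_mono fun x => ?_
    simp only [← ofReal_norm]
    rw [← ENNReal.ofReal_pow (norm_nonneg _), ← ENNReal.ofReal_pow (norm_nonneg _),
      ← ENNReal.ofReal_pow (norm_nonneg _),
      ← ENNReal.ofReal_add (by positivity) (by positivity), ← ENNReal.ofReal_ofNat 2,
      ← ENNReal.ofReal_mul (by norm_num)]
    refine ENNReal.ofReal_le_ofReal ?_
    have h1 := norm_sub_le (a (x + y * Complex.I)) (b (x + y * Complex.I))
    have h2 := pow_le_pow_left₀ (norm_nonneg _) h1 2
    nlinarith [sq_nonneg (‖a (x + y * Complex.I)‖ - ‖b (x + y * Complex.I)‖)]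

theorem lintegral_inv_one_add_sq_lt_top (x₀ K : ℝ) :
    ∫⁻ x : ℝ, ENNReal.ofReal (K * (1 + (x - x₀) ^ 2)⁻¹) < ∞ := by
  have h : Integrable fun x : ℝ => K * (1 + (x - x₀) ^ 2)⁻¹ :=
    (integrable_inv_one_add_sq.comp_sub_right x₀).const_mul K
  exact (lintegral_mono fun x => Real.ofReal_le_enorm _).trans_lt h.2

/-- The comparison functions, with pole below the real line: subtracting one makes a Hardy function
vanish at a prescribed point without leaving the class. -/
theorem isHardy_const_div {c a : ℂ} (ha : a.im < 0) : IsHardy 2 fun z => c / (z - a) := by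
  set d := min (-a.im) 1 with hd
  have hd0 : 0 < d := lt_min (by linarith) one_pos
  have hle : ∀ z : ℂ, 0 ≤ z.im → -a.im ≤ ‖z - a‖ := fun z hz => by
    have := Complex.abs_im_le_norm (z - a)
    rw [Complex.sub_im] at this
    have := le_abs_self (z.im - a.im)
    linarith
  have hne : ∀ z : ℂ, 0 ≤ z.im → z - a ≠ 0 := fun z hz h => by
    have := hle z hz
    rw [h, norm_zero] at this
    linarith
  have hsq : ∀ z : ℂ, 0 ≤ z.im → d ^ 2 / 2 * (1 + (z.re - a.re) ^ 2) ≤ ‖z - a‖ ^ 2 := by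
    intro z hz
    have h1 := hle z hz
    have h2 := Complex.sq_norm (z - a)
    rw [Complex.normSq_apply, Complex.sub_re, Complex.sub_im] at h2
    have h3 : d ^ 2 ≤ ‖z - a‖ ^ 2 := by
      have : d ≤ ‖z - a‖ := (min_le_left _ _).trans h1
      gcongr
    have h4 : d ^ 2 ≤ 1 := pow_le_one₀ hd0.le (min_le_right _ _)
    nlinarith [sq_nonneg (z.re - a.re), sq_nonneg (z.im - a.im)]
  refine ⟨fun z hz => ?_, ⟨‖c‖ / d, fun z hz => ?_⟩,
    ∫⁻ x : ℝ, ENNReal.ofReal (‖c‖ ^ 2 * (2 / d ^ 2) * (1 + (x - a.re) ^ 2)⁻¹),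
    lintegral_inv_one_add_sq_lt_top _ _, fun y hy => lintegral_mono fun x => ?_⟩
  · exact analyticAt_const.div (by fun_prop) (hne z hz)
  · rw [norm_div]
    gcongr
    exact (min_le_left _ _).trans (hle z (by linarith))
  · have him : ((x : ℂ) + y * Complex.I).im = y := by simp
    have hre : ((x : ℂ) + y * Complex.I).re = x := by simp
    have h1 := hsq (x + y * Complex.I) (by rw [him]; exact hy.1)
    rw [hre] at h1
    rw [← ofReal_norm, ← ENNReal.ofReal_pow (norm_nonneg _)]
    refine ENNReal.ofReal_le_ofReal ?_
    rw [norm_div, div_pow]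
    calc ‖c‖ ^ 2 / ‖(x : ℂ) + y * Complex.I - a‖ ^ 2
        ≤ ‖c‖ ^ 2 / (d ^ 2 / 2 * (1 + (x - a.re) ^ 2)) := by gcongr
      _ = _ := by field_simp

/-- Dividing out a zero of a Hardy function. -/
theorem IsHardy.dslope {U : ℂ → ℂ} (hU : IsHardy 2 U) {z₀ : ℂ} (hz₀ : 0 ≤ z₀.im)
    (h0 : U z₀ = 0) : IsHardy 1 (dslope U z₀) := by
  have han : AnalyticOnNhd ℂ (_root_.dslope U z₀) {z | 0 ≤ z.im} := by
    intro z hz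
    by_cases hzz : z = z₀
    · subst hzz
      obtain ⟨s, hs, hsd⟩ := (hU.analytic z hz).exists_mem_nhds_analyticOnNhd
      have h1 : DifferentiableOn ℂ (_root_.dslope U z) s :=
        (Complex.differentiableOn_dslope hs).2 hsd.differentiableOn
      exact h1.analyticAt hs
    · have h1 : AnalyticAt ℂ (fun w => (w - z₀)⁻¹ * (U w - U z₀)) z :=
        ((by fun_prop : AnalyticAt ℂ (fun w => w - z₀) z).inv (sub_ne_zero.2 hzz)).mul
          ((hU.analytic z hz).sub analyticAt_const)
      refine h1.congr ?_
      filter_upwards [isOpen_ne.mem_nhds hzz] with w hw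
      rw [dslope_of_ne _ hw, slope_def_module, smul_eq_mul]
  have hform : ∀ z, z ≠ z₀ → _root_.dslope U z₀ z = U z / (z - z₀) := fun z hz => by
    rw [dslope_of_ne _ hz, slope_def_module, h0, sub_zero, smul_eq_mul, div_eq_inv_mul]
  -- Within distance one of `z₀` the divided difference is bounded by compactness. Farther away it
  -- is `U` times 1 / (z - z₀), whose square is dominated on horizontal lines by an integrable
  -- function of x. The factor 2 + 2K below serves both cases.
  have hcpt : IsCompact (Metric.closedBall z₀ 1 ∩ {z : ℂ | 0 ≤ z.im}) :=
    (isCompact_closedBall z₀ 1).inter_right (isClosed_le continuous_const Complex.continuous_im)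
  obtain ⟨K, hK⟩ := hcpt.exists_bound_of_continuousOn
    (han.continuousOn.mono Set.inter_subset_right)
  have hK0 : 0 ≤ K := (norm_nonneg _).trans (hK z₀ ⟨Metric.mem_closedBall_self zero_le_one, hz₀⟩)
  have hnear : ∀ z : ℂ, 0 ≤ z.im → ‖z - z₀‖ ≤ 1 → ‖_root_.dslope U z₀ z‖ ≤ K := fun z hz h =>
    hK z ⟨by simpa [dist_eq_norm] using h, hz⟩
  have hfar : ∀ z : ℂ, 1 < ‖z - z₀‖ → ‖_root_.dslope U z₀ z‖ = ‖U z‖ / ‖z - z₀‖ := fun z h => by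
    rw [hform z, norm_div]
    rintro rfl
    simp at h
    linarith
  obtain ⟨B, hB⟩ := hU.bounded
  obtain ⟨M, hM, hM'⟩ := hU.mean
  refine ⟨han, ⟨max K B, fun z hz => ?_⟩,
    M + ∫⁻ x : ℝ, ENNReal.ofReal ((2 + 2 * K) * (1 + (x - z₀.re) ^ 2)⁻¹),
    ENNReal.add_lt_top.2 ⟨hM, lintegral_inv_one_add_sq_lt_top _ _⟩, fun y hy => ?_⟩
  · rcases le_or_gt ‖z - z₀‖ 1 with h | h
    · exact (hnear z (by linarith) h).trans (le_max_left _ _)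
    · rw [hfar z h]
      exact (div_le_self (norm_nonneg _) h.le).trans ((hB z hz).trans (le_max_right _ _))
  · refine le_trans ?_ (add_le_add_left (hM' y hy) _)
    rw [← lintegral_add_left
      ((hU.analytic.continuous_horizontal hy.1).enorm.measurable.pow_const 2)]
    refine lintegral_mono fun x => ?_
    set z : ℂ := x + y * Complex.I with hz
    have him : z.im = y := by simp [hz]
    have hre : z.re = x := by simp [hz]
    rw [pow_one, ← ofReal_norm, ← ofReal_norm, ← ENNReal.ofReal_pow (norm_nonneg _),
      ← ENNReal.ofReal_add (by positivity) (by positivity)]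
    refine ENNReal.ofReal_le_ofReal ?_
    have hs : (x - z₀.re) ^ 2 ≤ ‖z - z₀‖ ^ 2 := by
      rw [Complex.sq_norm, Complex.normSq_apply, Complex.sub_re, hre]
      nlinarith [mul_self_nonneg (z - z₀).im]
    have hp : 0 < 1 + (x - z₀.re) ^ 2 := by positivity
    rcases le_or_gt ‖z - z₀‖ 1 with h | h
    · refine (hnear z (by rw [him]; exact hy.1) h).trans ?_
      have h1 : ‖z - z₀‖ ^ 2 ≤ 1 := pow_le_one₀ (norm_nonneg _) h
      have h2 : K ≤ (2 + 2 * K) * (1 + (x - z₀.re) ^ 2)⁻¹ := by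
        rw [← div_eq_mul_inv, le_div_iff₀ hp]
        nlinarith
      have := sq_nonneg ‖U z‖
      linarith
    · rw [hfar z h, div_eq_mul_inv]
      refine mul_le_sq_add_sq.trans (add_le_add_right ?_ _)
      rw [inv_pow, ← div_eq_mul_inv, le_div_iff₀ hp, inv_mul_le_iff₀ (by positivity)]
      have h1 : 1 ≤ ‖z - z₀‖ ^ 2 := one_le_pow₀ h.le
      nlinarith

theorem ae_ne_ofReal (z₀ : ℂ) : ∀ᵐ t : ℝ, (t : ℂ) ≠ z₀ := by
  have : ({z₀.re} : Set ℝ)ᶜ ∈ ae volume := compl_mem_ae_iff.2 (by simp)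
  filter_upwards [this] with t ht h
  exact ht (by simp [← h])

/-- Cauchy's theorem for the Hardy space, with the value at `z₀` subtracted. -/
theorem IsHardy.integral_sub_div {u : ℂ → ℂ} (hu : IsHardy 2 u) {z₀ a : ℂ} (hz₀ : 0 ≤ z₀.im)
    (ha : a.im < 0) :
    Integrable (fun t : ℝ => (u t - u z₀ * (z₀ - a) / (t - a)) / (t - z₀)) ∧
      ∫ t : ℝ, (u t - u z₀ * (z₀ - a) / (t - a)) / (t - z₀) = 0 := by
  have hne : z₀ - a ≠ 0 := fun h => by
    have := congrArg Complex.im h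
    simp at this
    linarith
  have hU := hu.sub (isHardy_const_div (c := u z₀ * (z₀ - a)) ha)
  have hd := hU.dslope hz₀ (by field_simp; simp)
  have hae : (fun t : ℝ => _root_.dslope (fun z => u z - u z₀ * (z₀ - a) / (z - a)) z₀ t) =ᵐ[volume]
      fun t : ℝ => (u t - u z₀ * (z₀ - a) / (t - a)) / (t - z₀) := by
    filter_upwards [ae_ne_ofReal z₀] with t ht
    rw [dslope_of_ne _ ht, slope_def_module, mul_div_cancel_right₀ _ hne, sub_self, sub_zero,
      smul_eq_mul]
    ring
  exact ⟨hd.integrable.congr hae, by rw [← integral_congr_ae hae]; exact hd.integral_eq_zero⟩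

theorem integral_inv_norm_sub_sq {z : ℂ} (hz : 0 < z.im) :
    Integrable (fun t : ℝ => 1 / ‖(t : ℂ) - z‖ ^ 2) ∧
      ∫ t : ℝ, 1 / ‖(t : ℂ) - z‖ ^ 2 = Real.pi / z.im := by
  set γ : NNReal := ⟨z.im, hz.le⟩ with hγ
  have hγy : (γ : ℝ) = z.im := rfl
  have hγ0 : γ ≠ 0 := fun h => by
    have := congrArg NNReal.toReal h
    exact hz.ne' this
  have h : ∀ t : ℝ, 1 / ‖(t : ℂ) - z‖ ^ 2 =
      Real.pi / z.im * ProbabilityTheory.cauchyPDFReal z.re γ t := by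
    intro t
    rw [ProbabilityTheory.cauchyPDFReal_def, hγy, Complex.sq_norm, Complex.normSq_apply]
    simp only [Complex.sub_re, Complex.ofReal_re, Complex.sub_im, Complex.ofReal_im, zero_sub]
    have : (t - z.re) ^ 2 + z.im ^ 2 ≠ 0 := by positivity
    have := Real.pi_ne_zero
    rw [← sq, ← sq, neg_sq]
    field_simp
  simp only [h]
  refine ⟨(ProbabilityTheory.integrable_cauchyPDFReal z.re).const_mul _, ?_⟩
  rw [integral_const_mul, ProbabilityTheory.integral_cauchyPDFReal_eq_one z.re hγ0, mul_one]

theorem memLp_inv_sub {z : ℂ} (hz : 0 < z.im) : MemLp (fun t : ℝ => 1 / ((t : ℂ) - z)) 2 := by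
  have hne : ∀ t : ℝ, (t : ℂ) - z ≠ 0 := fun t h => by
    have := congrArg Complex.im h
    simp at this
    exact hz.ne' this
  refine (memLp_two_iff_integrable_sq_norm (Continuous.aestronglyMeasurable ?_)).2 ?_
  · exact Continuous.div (by fun_prop) (by fun_prop) hne
  · simpa [norm_div] using (integral_inv_norm_sub_sq hz).1

/-- Cauchy's integral formula for the Hardy space of the upper half-plane. -/
theorem IsHardy.integral_div_sub {u : ℂ → ℂ} (hu : IsHardy 2 u) {z : ℂ} (hz : 0 < z.im) :
    ∫ t : ℝ, u t * (1 / (t - z)) = 2 * Real.pi * Complex.I * u z := by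
  have hne : ∀ t : ℝ, (t : ℂ) - z ≠ 0 := fun t h => by
    have := congrArg Complex.im h
    simp at this
    exact hz.ne' this
  have hne' : ∀ t : ℝ, (t : ℂ) - conj z ≠ 0 := fun t h => by
    have := congrArg Complex.im h
    simp at this
    exact hz.ne' this
  -- With a = conj z the subtracted term, divided by t - z, is u(z) (z - conj z) / |t - z|², a
  -- multiple of the Cauchy density with known integral.
  obtain ⟨h1, h2⟩ := hu.integral_sub_div (a := conj z) hz.le (by simpa using hz)
  have hsq : ∀ t : ℝ, (((1 / ‖(t : ℂ) - z‖ ^ 2 : ℝ)) : ℂ) = 1 / ((t - conj z) * (t - z)) := by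
    intro t
    have h3 : (t : ℂ) - conj z = conj ((t : ℂ) - z) := by simp
    rw [h3, ← Complex.normSq_eq_conj_mul_self, Complex.normSq_eq_norm_sq]
    push_cast
    rfl
  have hdec : ∀ t : ℝ, u t * (1 / (t - z)) = (u t - u z * (z - conj z) / (t - conj z)) / (t - z) +
      u z * (z - conj z) * (((1 / ‖(t : ℂ) - z‖ ^ 2 : ℝ)) : ℂ) := by
    intro t
    rw [hsq]
    have := hne t
    have := hne' t
    field_simp
    ring
  obtain ⟨h4, h5⟩ := integral_inv_norm_sub_sq hz
  have h6 : Integrable fun t : ℝ =>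
    u z * (z - conj z) * (((1 / ‖(t : ℂ) - z‖ ^ 2 : ℝ)) : ℂ) := h4.ofReal.const_mul _
  simp only [hdec]
  rw [integral_add h1 h6, h2, integral_const_mul, integral_complex_ofReal, h5,
    Complex.sub_conj]
  push_cast
  have : (z.im : ℂ) ≠ 0 := by exact_mod_cast hz.ne'
  field_simp
  ring

/-! ### Hermite-Biehler functions and the quotients f / E -/

theorem entireStar_entireStar (f : ℂ → ℂ) : entireStar (entireStar f) = f := by
  ext z; simp [entireStar]

theorem entireStar_ofReal (f : ℂ → ℂ) (t : ℝ) : entireStar f t = conj (f t) := by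
  simp [entireStar]

theorem Differentiable.entireStar {f : ℂ → ℂ} (hf : Differentiable ℂ f) :
    Differentiable ℂ (entireStar f) := fun z => by
  have := (hf (conj z)).conj_conj
  rw [Complex.conj_conj] at this
  exact this

namespace IsHermiteBiehler

variable {E : ℂ → ℂ}

theorem ne_zero (hE : IsHermiteBiehler E) {z : ℂ} (hz : 0 < z.im) : E z ≠ 0 :=
  norm_pos_iff.1 ((norm_nonneg _).trans_lt (hE.norm_conj_lt z hz))

theorem analyticOnNhd (hE : IsHermiteBiehler E) : AnalyticOnNhd ℂ E Set.univ :=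
  hE.entire.differentiableOn.analyticOnNhd isOpen_univ

/-- Real zeros of `E` form a null set, so the value that division by zero assigns to f / E there is
irrelevant to all integrals. -/
theorem ae_ne_zero (hE : IsHermiteBiehler E) : ∀ᵐ t : ℝ, E t ≠ 0 := by
  have h := hE.analyticOnNhd.countable_zeros isPreconnected_univ (Set.mem_univ Complex.I)
    (hE.ne_zero (by simp))
  have h2 : {t : ℝ | E t = 0}.Countable := by
    refine (h.preimage Complex.ofReal_injective).mono fun t ht => ?_
    exact ⟨Set.mem_univ _, ht⟩
  simpa [ae_iff] using h2.measure_zero volume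

theorem eventually_ne_zero (hE : IsHermiteBiehler E) (z : ℂ) : ∀ᶠ w in 𝓝[≠] z, E w ≠ 0 := by
  rcases (hE.analyticOnNhd z (Set.mem_univ z)).eventually_eq_zero_or_eventually_ne_zero with h | h
  · have := hE.analyticOnNhd.eqOn_zero_of_preconnected_of_eventuallyEq_zero isPreconnected_univ
      (Set.mem_univ z) h (Set.mem_univ Complex.I)
    exact absurd this (hE.ne_zero (by simp))
  · exact h

theorem norm_entireStar_lt (hE : IsHermiteBiehler E) {z : ℂ} (hz : 0 < z.im) :
    ‖entireStar E z‖ < ‖E z‖ := by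
  rw [entireStar, RCLike.norm_conj]
  exact hE.norm_conj_lt z hz

theorem mul {F : ℂ → ℂ} (hE : IsHermiteBiehler E) (hF : IsHermiteBiehler F) :
    IsHermiteBiehler (E * F) := by
  refine ⟨hE.entire.mul hF.entire, fun z hz => ?_⟩
  simp only [Pi.mul_apply, norm_mul]
  exact mul_lt_mul'' (hE.norm_conj_lt z hz) (hF.norm_conj_lt z hz) (norm_nonneg _) (norm_nonneg _)

theorem aestronglyMeasurable_div (hE : IsHermiteBiehler E) {f : ℂ → ℂ} (hf : Differentiable ℂ f) :
    AEStronglyMeasurable fun t : ℝ => f t / E t := by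
  have h1 : Measurable fun t : ℝ => f t := (hf.continuous.comp Complex.continuous_ofReal).measurable
  have h2 : Measurable fun t : ℝ => E t :=
    (hE.entire.continuous.comp Complex.continuous_ofReal).measurable
  exact (h1.div h2).aestronglyMeasurable

theorem memLp_div (hE : IsHermiteBiehler E) {f : ℂ → ℂ} (hf : Differentiable ℂ f)
    (hfin : deBrangesNormSq E f < ∞) : MemLp (fun t : ℝ => f t / E t) 2 := by
  refine (memLp_two_iff_integrable_sq_norm (hE.aestronglyMeasurable_div hf)).2
    ⟨(hE.aestronglyMeasurable_div hf).norm.pow 2, ?_⟩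
  rw [HasFiniteIntegral]
  simp only [enorm_pow, enorm_norm]
  exact hfin

end IsHermiteBiehler

/-- A meromorphic function that is locally integrable on the real line has no real poles. -/
theorem MeromorphicAt.meromorphicOrderAt_nonneg_of_intervalIntegrable {g : ℂ → ℂ} {l : ℝ}
    (hg : MeromorphicAt g l)
    (hint : IntervalIntegrable (fun t : ℝ => g t) volume (l - 1) (l + 1)) :
    0 ≤ meromorphicOrderAt g l := by
  by_contra hneg
  rw [not_le] at hneg
  obtain ⟨n, hn⟩ := WithTop.ne_top_iff_exists.1 (hneg.trans_le le_top).ne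
  obtain ⟨h, hh, hh0, heq⟩ := (meromorphicOrderAt_eq_int_iff hg).1 hn.symm
  have hn1 : n ≤ -1 := by
    rw [← hn] at hneg
    have : n < 0 := by exact_mod_cast hneg
    omega
  set c := ‖h l‖ / 2 with hc
  have hc0 : 0 < c := by have := norm_pos_iff.2 hh0; positivity
  have h1 : ∀ᶠ z in 𝓝[≠] (l : ℂ), c < ‖h z‖ :=
    (hh.continuousAt.norm.eventually_const_lt (half_lt_self (norm_pos_iff.2 hh0))).filter_mono
      nhdsWithin_le_nhds
  have h2 : ∀ᶠ z in 𝓝[≠] (l : ℂ), ‖z - (l : ℂ)‖ < 1 := by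
    have : ∀ᶠ z in 𝓝 (l : ℂ), z ∈ Metric.ball (l : ℂ) 1 := Metric.ball_mem_nhds _ one_pos
    filter_upwards [this.filter_mono nhdsWithin_le_nhds] with z hz
    simpa [dist_eq_norm] using hz
  -- At a pole |g| is at least a constant times 1 / |z - l|, which is not integrable across `l` on
  -- the real line.
  have h3 : ∀ᶠ z in 𝓝[≠] (l : ℂ), ‖(z - (l : ℂ))⁻¹‖ ≤ c⁻¹ * ‖g z‖ := by
    filter_upwards [h1, h2, heq, self_mem_nhdsWithin] with z hz1 hz2 hz3 hz4
    have hpos : 0 < ‖z - l‖ := norm_pos_iff.2 (sub_ne_zero.2 hz4)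
    rw [hz3, norm_smul, norm_zpow, norm_inv, ← zpow_neg_one]
    calc ‖z - l‖ ^ (-1 : ℤ) ≤ ‖z - l‖ ^ n := zpow_le_zpow_right_of_le_one₀ hpos hz2.le hn1
      _ = c⁻¹ * (‖z - l‖ ^ n * c) := by field_simp
      _ ≤ _ := by gcongr
  have h4 : Tendsto (fun t : ℝ => (t : ℂ)) (𝓝[≠] l) (𝓝[≠] (l : ℂ)) := by
    refine tendsto_nhdsWithin_iff.2 ⟨?_, ?_⟩
    · exact (Complex.continuous_ofReal.tendsto l).mono_left nhdsWithin_le_nhds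
    · filter_upwards [self_mem_nhdsWithin] with t ht
      simpa using ht
  refine not_intervalIntegrable_of_sub_inv_isBigO_punctured (c := l) ?_ (by linarith) ?_ hint
  · refine Asymptotics.IsBigO.of_bound c⁻¹ ?_
    filter_upwards [h4.eventually h3] with t ht
    rwa [← Complex.ofReal_sub, ← Complex.ofReal_inv, Complex.norm_real] at ht
  · rw [Set.uIcc_of_le (by linarith)]
    constructor <;> linarith

/-- The quotient `f / E` extends analytically to the closed upper half-plane. -/
theorem IsHermiteBiehler.exists_analytic_quotient {E f : ℂ → ℂ} (hE : IsHermiteBiehler E)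
    (hf : Differentiable ℂ f) (hfin : deBrangesNormSq E f < ∞) :
    ∃ u : ℂ → ℂ, AnalyticOnNhd ℂ u {z | 0 ≤ z.im} ∧ ∀ z : ℂ, 0 ≤ z.im → u z * E z = f z := by
  set g : ℂ → ℂ := fun z => f z / E z with hg
  have hfa : AnalyticOnNhd ℂ f Set.univ := hf.differentiableOn.analyticOnNhd isOpen_univ
  have hgm : MeromorphicOn g Set.univ := fun z hz =>
    (hfa z hz).meromorphicAt.div (hE.analyticOnNhd z hz).meromorphicAt
  -- The normal form replaces the default value 0 of f / E at a real zero of `E` by the limit; that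
  -- the singularity is removable follows from local integrability.
  set u := toMeromorphicNFOn g Set.univ with hu
  have hua : AnalyticOnNhd ℂ u {z | 0 ≤ z.im} := by
    intro z hz
    rw [← (meromorphicNFOn_toMeromorphicNFOn g Set.univ (Set.mem_univ z)
      ).meromorphicOrderAt_nonneg_iff_analyticAt,
      meromorphicOrderAt_toMeromorphicNFOn hgm (Set.mem_univ z)]
    by_cases hEz : E z = 0
    · have hzr : z.im = 0 := by
        by_contra h
        exact hE.ne_zero (lt_of_le_of_ne hz (Ne.symm h)) hEz
      have hzz : z = ((z.re : ℝ) : ℂ) := Complex.ext rfl (by simpa using hzr)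
      rw [hzz]
      refine (hgm _ (Set.mem_univ _)).meromorphicOrderAt_nonneg_of_intervalIntegrable ?_
      have hloc : LocallyIntegrable (fun t : ℝ => f t / E t) :=
        (hE.memLp_div hf hfin).locallyIntegrable (by norm_num)
      exact (hloc.integrableOn_isCompact isCompact_uIcc).intervalIntegrable
    · exact ((hfa z (Set.mem_univ z)).div (hE.analyticOnNhd z (Set.mem_univ z))
        hEz).meromorphicOrderAt_nonneg
  refine ⟨u, hua, fun z hz => ?_⟩
  have h1 : (fun w => u w * E w) =ᶠ[𝓝[≠] z] f := by
    filter_upwards [hgm.toMeromorphicNFOn_eq_self_on_nhdsNE (Set.mem_univ z),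
      hE.eventually_ne_zero z] with w hw hw'
    rw [hu, hw, hg]
    exact div_mul_cancel₀ _ hw'
  have h2 : ContinuousAt (fun w => u w * E w) z :=
    (hua z hz).continuousAt.mul hE.entire.continuous.continuousAt
  exact ((h2.eventuallyEq_nhds_iff_eventuallyEq_nhdsNE hf.continuous.continuousAt).1 h1).eq_of_nhds

/-! ### Closure properties of bounded type and mean type -/

/-- Bounded type and nonpositive mean type. -/
def IsTame (f : ℂ → ℂ) : Prop := IsBoundedType f ∧ meanType f ≤ 0

theorem isOpen_upper : IsOpen {z : ℂ | 0 < z.im} := isOpen_lt continuous_const Complex.continuous_im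

theorem isPreconnected_upper : IsPreconnected {z : ℂ | 0 < z.im} :=
  (convex_halfSpace_im_gt 0).isPreconnected

/-- Keeps the product of two denominators from vanishing identically: each zero set is countable, so
the complement of their union is dense. -/
theorem exists_mul_ne_zero_of_analytic {P Q : ℂ → ℂ} (hP : DifferentiableOn ℂ P {z | 0 < z.im})
    (hQ : DifferentiableOn ℂ Q {z | 0 < z.im}) (hP0 : ∃ z : ℂ, 0 < z.im ∧ P z ≠ 0)
    (hQ0 : ∃ z : ℂ, 0 < z.im ∧ Q z ≠ 0) : ∃ z : ℂ, 0 < z.im ∧ P z * Q z ≠ 0 := by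
  obtain ⟨a, ha, hPa⟩ := hP0
  obtain ⟨b, hb, hQb⟩ := hQ0
  have hc := ((hP.analyticOnNhd isOpen_upper).countable_zeros isPreconnected_upper ha hPa).union
    ((hQ.analyticOnNhd isOpen_upper).countable_zeros isPreconnected_upper hb hQb)
  obtain ⟨z, hz, hz'⟩ := (hc.dense_compl ℝ).exists_mem_open isOpen_upper ⟨a, ha⟩
  refine ⟨z, hz', fun h => hz ?_⟩
  exact (mul_eq_zero.1 h).imp (fun h => ⟨hz', h⟩) fun h => ⟨hz', h⟩

theorem IsBoundedType.congr {f g : ℂ → ℂ} (hf : IsBoundedType f)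
    (h : ∀ z : ℂ, 0 < z.im → g z = f z) : IsBoundedType g := by
  obtain ⟨hd, P, Q, hP, hQ, hM, hQ0, he⟩ := hf
  exact ⟨hd.congr h, P, Q, hP, hQ, hM, hQ0, fun z hz => by rw [h z hz, he z hz]⟩

theorem IsBoundedType.add {f g : ℂ → ℂ} (hf : IsBoundedType f) (hg : IsBoundedType g) :
    IsBoundedType fun z => f z + g z := by
  obtain ⟨hd, P, Q, hP, hQ, ⟨M, hM⟩, hQ0, he⟩ := hf
  obtain ⟨hd', P', Q', hP', hQ', ⟨M', hM'⟩, hQ0', he'⟩ := hg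
  have hmul : ∀ a b : ℂ, ‖a‖ ≤ M → ‖b‖ ≤ M' → ‖a * b‖ ≤ M * M' := fun a b ha hb => by
    rw [norm_mul]
    exact mul_le_mul ha hb (norm_nonneg _) ((norm_nonneg _).trans ha)
  refine ⟨hd.add hd', fun z => P z * Q' z + Q z * P' z, fun z => Q z * Q' z,
    (hP.mul hQ').add (hQ.mul hP'), hQ.mul hQ', ⟨M * M' + M * M', fun z hz => ?_⟩,
    exists_mul_ne_zero_of_analytic hQ hQ' hQ0 hQ0', fun z hz => ?_⟩
  · have h1 := hmul _ _ (hM z hz).1 (hM' z hz).2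
    have h2 := hmul _ _ (hM z hz).2 (hM' z hz).1
    have h3 := hmul _ _ (hM z hz).2 (hM' z hz).2
    refine ⟨(norm_add_le _ _).trans (add_le_add h1 h2), h3.trans ?_⟩
    have := (norm_nonneg _).trans h3
    linarith
  · simp only [← he z hz, ← he' z hz]; ring

theorem IsBoundedType.mul {f g : ℂ → ℂ} (hf : IsBoundedType f) (hg : IsBoundedType g) :
    IsBoundedType fun z => f z * g z := by
  obtain ⟨hd, P, Q, hP, hQ, ⟨M, hM⟩, hQ0, he⟩ := hf
  obtain ⟨hd', P', Q', hP', hQ', ⟨M', hM'⟩, hQ0', he'⟩ := hg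
  have hmul : ∀ a b : ℂ, ‖a‖ ≤ M → ‖b‖ ≤ M' → ‖a * b‖ ≤ M * M' := fun a b ha hb => by
    rw [norm_mul]
    exact mul_le_mul ha hb (norm_nonneg _) ((norm_nonneg _).trans ha)
  refine ⟨hd.mul hd', fun z => P z * P' z, fun z => Q z * Q' z,
    hP.mul hP', hQ.mul hQ', ⟨M * M', fun z hz => ?_⟩,
    exists_mul_ne_zero_of_analytic hQ hQ' hQ0 hQ0', fun z hz => ?_⟩
  · exact ⟨hmul _ _ (hM z hz).1 (hM' z hz).1, hmul _ _ (hM z hz).2 (hM' z hz).2⟩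
  · simp only [← he z hz, ← he' z hz]; ring

theorem meanType_nonpos_of_bounded {f : ℂ → ℂ} {M : ℝ}
    (hM : ∀ᶠ y : ℝ in atTop, ‖f (y * Complex.I)‖ ≤ M) : meanType f ≤ 0 := by
  refine meanType_nonpos_iff.2 fun ε hε => ?_
  have h : Tendsto (fun y : ℝ => Real.exp (ε * y)) atTop atTop :=
    Real.tendsto_exp_atTop.comp (tendsto_id.const_mul_atTop hε)
  filter_upwards [hM, h.eventually_ge_atTop M] with y h1 h2 using h1.trans h2

namespace IsTame

theorem congr {f g : ℂ → ℂ} (hf : IsTame f) (h : ∀ z : ℂ, 0 < z.im → g z = f z) : IsTame g := by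
  refine ⟨hf.1.congr h, meanType_nonpos_iff.2 fun ε hε => ?_⟩
  filter_upwards [meanType_nonpos_iff.1 hf.2 ε hε, eventually_gt_atTop 0] with y hy hy0
  rwa [h _ (by simpa using hy0)]

theorem mul {f g : ℂ → ℂ} (hf : IsTame f) (hg : IsTame g) : IsTame fun z => f z * g z := by
  refine ⟨hf.1.mul hg.1, meanType_nonpos_iff.2 fun ε hε => ?_⟩
  filter_upwards [meanType_nonpos_iff.1 hf.2 (ε / 2) (by positivity),
    meanType_nonpos_iff.1 hg.2 (ε / 2) (by positivity)] with y h1 h2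
  have : ε * y = ε / 2 * y + ε / 2 * y := by ring
  rw [norm_mul, this, Real.exp_add]
  exact mul_le_mul h1 h2 (norm_nonneg _) (Real.exp_nonneg _)

theorem add {f g : ℂ → ℂ} (hf : IsTame f) (hg : IsTame g) : IsTame fun z => f z + g z := by
  refine ⟨hf.1.add hg.1, meanType_nonpos_iff.2 fun ε hε => ?_⟩
  -- Half of ε is spent on absorbing the factor two of the triangle inequality.
  have h : Tendsto (fun y : ℝ => Real.exp (ε / 2 * y)) atTop atTop :=
    Real.tendsto_exp_atTop.comp (tendsto_id.const_mul_atTop (by positivity))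
  filter_upwards [meanType_nonpos_iff.1 hf.2 (ε / 2) (by positivity),
    meanType_nonpos_iff.1 hg.2 (ε / 2) (by positivity), h.eventually_ge_atTop 2] with y h1 h2 h3
  have : ε * y = ε / 2 * y + ε / 2 * y := by ring
  rw [this, Real.exp_add]
  refine (norm_add_le _ _).trans ?_
  nlinarith [Real.exp_nonneg (ε / 2 * y)]

theorem of_bounded {f : ℂ → ℂ} (hd : DifferentiableOn ℂ f {z | 0 < z.im}) {M : ℝ}
    (hM : ∀ z : ℂ, 0 < z.im → ‖f z‖ ≤ M) : IsTame f := by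
  refine ⟨⟨hd, f, fun _ => 1, hd, differentiableOn_const _, ⟨max M 1, fun z hz => ⟨?_, ?_⟩⟩,
    ⟨Complex.I, by simp, one_ne_zero⟩, fun z _ => mul_one _⟩, ?_⟩
  · exact (hM z hz).trans (le_max_left _ _)
  · simp
  · refine meanType_nonpos_of_bounded (M := M) ?_
    filter_upwards [eventually_gt_atTop 0] with y hy using hM _ (by simpa using hy)

theorem const (c : ℂ) : IsTame fun _ => c :=
  of_bounded (differentiableOn_const c) (M := ‖c‖) fun _ _ => le_rfl

end IsTame

theorem IsHermiteBiehler.isTame_star_div {E : ℂ → ℂ} (hE : IsHermiteBiehler E) :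
    IsTame fun z => entireStar E z / E z := by
  refine IsTame.of_bounded (M := 1) ?_ fun z hz => ?_
  · exact hE.entire.entireStar.differentiableOn.div hE.entire.differentiableOn fun z hz =>
      hE.ne_zero hz
  · rw [norm_div]
    exact div_le_one_of_le₀ (hE.norm_entireStar_lt hz).le (norm_nonneg _)

theorem deBrangesNormSq_entireStar (E f : ℂ → ℂ) :
    deBrangesNormSq E (entireStar f) = deBrangesNormSq E f := by
  refine lintegral_congr fun t => ?_
  rw [entireStar_ofReal, ← ofReal_norm, ← ofReal_norm, norm_div, norm_div, RCLike.norm_conj]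

theorem entireStar_mem_deBrangesSpace {E f : ℂ → ℂ} (hf : f ∈ deBrangesSpace E) :
    entireStar f ∈ deBrangesSpace E := by
  obtain ⟨hd, hfin, h1, h2⟩ := hf
  refine ⟨hd.entireStar, by rwa [deBrangesNormSq_entireStar], h2, ?_⟩
  rwa [entireStar_entireStar]

/-- Elements of the de Branges space are products of `E` and Hardy functions. -/
theorem IsHermiteBiehler.exists_isHardy {E f : ℂ → ℂ} (hE : IsHermiteBiehler E)
    (hf : f ∈ deBrangesSpace E) :
    ∃ u : ℂ → ℂ, IsHardy 2 u ∧ ∀ z : ℂ, 0 ≤ z.im → u z * E z = f z := by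
  obtain ⟨hd, hfin, h1, -⟩ := hf
  obtain ⟨u, hu, huE⟩ := hE.exists_analytic_quotient hd hfin
  have hdiv : ∀ z : ℂ, 0 ≤ z.im → E z ≠ 0 → u z = f z / E z := fun z hz h0 =>
    eq_div_of_mul_eq h0 (huE z hz)
  have htame : IsTame u := IsTame.congr (f := fun z => f z / E z) h1 fun z hz =>
    hdiv z hz.le (hE.ne_zero hz)
  refine ⟨u, htame.1.isHardy hu htame.2 ?_, huE⟩
  refine ((memLp_two_iff_integrable_sq_norm (hE.aestronglyMeasurable_div hd)).1
    (hE.memLp_div hd hfin)).congr ?_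
  filter_upwards [hE.ae_ne_zero] with t ht
  rw [hdiv t (by simp) ht]

/-! ### The de Branges space inside L² -/

/-- The de Branges space as a subspace of the space of all functions. -/
def deBrangesSubmodule {E : ℂ → ℂ} (hE : IsHermiteBiehler E) : Submodule ℂ (ℂ → ℂ) where
  carrier := deBrangesSpace E
  zero_mem' := by
    have h0 : IsTame fun z => (0 : ℂ → ℂ) z / E z := by simpa using IsTame.const 0
    refine ⟨differentiable_const 0, by simp [deBrangesNormSq], h0, ?_⟩
    have : entireStar 0 = 0 := by ext z; simp [entireStar]
    rw [this]
    exact h0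
  add_mem' := by
    rintro f g ⟨hfd, hfn, hf1, hf2⟩ ⟨hgd, hgn, hg1, hg2⟩
    refine ⟨hfd.add hgd, ?_, ?_, ?_⟩
    · have h := (hE.memLp_div hfd hfn).add (hE.memLp_div hgd hgn)
      have h2 := ((memLp_two_iff_integrable_sq_norm h.1).1 h).2
      rw [HasFiniteIntegral] at h2
      simp only [enorm_pow, enorm_norm] at h2
      refine lt_of_eq_of_lt (lintegral_congr fun t => ?_) h2
      simp only [Pi.add_apply, add_div]
    · exact (IsTame.add hf1 hg1).congr fun z _ => by simp only [Pi.add_apply, add_div]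
    · refine (IsTame.add hf2 hg2).congr fun z _ => ?_
      simp only [entireStar, Pi.add_apply, add_div, map_add]
  smul_mem' := by
    rintro c f ⟨hfd, hfn, hf1, hf2⟩
    refine ⟨hfd.const_smul c, ?_, ?_, ?_⟩
    · have h := (hE.memLp_div hfd hfn).const_smul c
      have h2 := ((memLp_two_iff_integrable_sq_norm h.1).1 h).2
      rw [HasFiniteIntegral] at h2
      simp only [enorm_pow, enorm_norm] at h2
      refine lt_of_eq_of_lt (lintegral_congr fun t => ?_) h2
      simp only [Pi.smul_apply, smul_eq_mul, mul_div_assoc]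
    · exact ((IsTame.const c).mul hf1).congr fun z _ => by
        simp only [Pi.smul_apply, smul_eq_mul, mul_div_assoc]
    · refine ((IsTame.const (conj c)).mul hf2).congr fun z _ => ?_
      simp only [entireStar, Pi.smul_apply, smul_eq_mul, mul_div_assoc, map_mul]

namespace IsHermiteBiehler

variable {E : ℂ → ℂ}

/-- The isometric embedding of the de Branges space into `L²(ℝ)`. -/
def toL2 (hE : IsHermiteBiehler E) :
    deBrangesSubmodule hE →ₗ[ℂ] Lp ℂ 2 (volume : Measure ℝ) where
  toFun f := (hE.memLp_div f.2.1 f.2.2.1).toLp _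
  map_add' f g := by
    rw [← MemLp.toLp_add]
    refine MemLp.toLp_congr _ _ (ae_of_all _ fun t => ?_)
    simp [add_div]
  map_smul' c f := by
    rw [RingHom.id_apply, ← MemLp.toLp_const_smul]
    refine MemLp.toLp_congr _ _ (ae_of_all _ fun t => ?_)
    simp [mul_div_assoc]

theorem coeFn_toL2 (hE : IsHermiteBiehler E) (f : deBrangesSubmodule hE) :
    hE.toL2 f =ᵐ[volume] fun t : ℝ => f.1 t / E t :=
  (hE.memLp_div f.2.1 f.2.2.1).coeFn_toLp

theorem deBrangesNormSq_eq (hE : IsHermiteBiehler E) (f : deBrangesSubmodule hE) :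
    deBrangesNormSq E f.1 = ‖hE.toL2 f‖ₑ ^ 2 := by
  have h1 : ‖hE.toL2 f‖ₑ = eLpNorm (fun t : ℝ => f.1 t / E t) 2 volume := by
    rw [Lp.enorm_def, eLpNorm_congr_ae (hE.coeFn_toL2 f)]
  have h2 := eLpNorm_nnreal_pow_eq_lintegral (f := fun t : ℝ => f.1 t / E t) (μ := volume)
    (p := 2) two_ne_zero
  rw [h1]
  simpa [deBrangesNormSq] using h2.symm

theorem inner_toL2 (hE : IsHermiteBiehler E) (f g : deBrangesSubmodule hE) :
    inner ℂ (hE.toL2 f) (hE.toL2 g) = ∫ t : ℝ, conj (f.1 t / E t) * (g.1 t / E t) := by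
  rw [L2.inner_def]
  refine integral_congr_ae ?_
  filter_upwards [hE.coeFn_toL2 f, hE.coeFn_toL2 g] with t h1 h2
  rw [h1, h2, RCLike.inner_apply, mul_comm]

end IsHermiteBiehler

/-! ### The reproducing kernel and point evaluations -/

theorem kernelNumerator_conj (E : ℂ → ℂ) (w : ℂ) : kernelNumerator E w (conj w) = 0 := by
  simp [kernelNumerator, entireStar]; ring

/-- As a divided difference of an entire function at one of its zeros, the kernel is visibly entire
in z. -/
theorem deBrangesKernel_eq_dslope (E : ℂ → ℂ) (w z : ℂ) :
    deBrangesKernel E w z =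
      -(2 * Real.pi * Complex.I)⁻¹ * dslope (kernelNumerator E w) (conj w) z := by
  unfold deBrangesKernel
  split_ifs with h
  · rw [h, dslope_same]; ring
  · have h1 : z - conj w ≠ 0 := sub_ne_zero.2 h
    have h2 : conj w - z ≠ 0 := sub_ne_zero.2 (Ne.symm h)
    have h3 : conj w - z = -(z - conj w) := by ring
    rw [dslope_of_ne _ h, slope_def_module, kernelNumerator_conj, sub_zero, smul_eq_mul, h3]
    field_simp

theorem Differentiable.kernelNumerator {E : ℂ → ℂ} (hE : Differentiable ℂ E) (w : ℂ) :
    Differentiable ℂ (kernelNumerator E w) := by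
  have := hE.entireStar
  unfold _root_.kernelNumerator
  fun_prop

theorem Differentiable.deBrangesKernel {E : ℂ → ℂ} (hE : Differentiable ℂ E) (w : ℂ) :
    Differentiable ℂ (deBrangesKernel E w) := by
  have h1 : Differentiable ℂ (dslope (_root_.kernelNumerator E w) (conj w)) := by
    rw [← differentiableOn_univ, Complex.differentiableOn_dslope univ_mem]
    exact (hE.kernelNumerator w).differentiableOn
  have h2 : _root_.deBrangesKernel E w = fun z => -(2 * Real.pi * Complex.I)⁻¹ *
      dslope (_root_.kernelNumerator E w) (conj w) z := funext (deBrangesKernel_eq_dslope E w)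
  rw [h2]
  exact h1.const_mul _

theorem deBrangesKernel_of_ne {E : ℂ → ℂ} {l : ℝ} {z : ℂ} (h : z ≠ l) :
    deBrangesKernel E l z =
      (conj (E l) * E z - E l * entireStar E z) / (2 * Real.pi * Complex.I * (l - z)) := by
  rw [deBrangesKernel, if_neg (by simpa using h), kernelNumerator, Complex.conj_ofReal]

/-- For a real parameter this merges the conditions on f / E and f* / E into one. -/
theorem entireStar_deBrangesKernel {E : ℂ → ℂ} (hE : Differentiable ℂ E) (l : ℝ) :
    entireStar (deBrangesKernel E l) = deBrangesKernel E l := by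
  have hd := hE.deBrangesKernel l
  refine Continuous.ext_on (dense_compl_singleton (l : ℂ)) hd.entireStar.continuous hd.continuous
    fun z hz => ?_
  have hz' : conj z ≠ (l : ℂ) := fun h => hz <| by
    have := congrArg conj h
    simpa using this
  have hz0 : (l : ℂ) - z ≠ 0 := sub_ne_zero.2 (Ne.symm hz)
  rw [entireStar, deBrangesKernel_of_ne hz', deBrangesKernel_of_ne hz]
  simp only [map_div₀, map_sub, map_mul, Complex.conj_conj, entireStar, Complex.conj_ofReal,
    Complex.conj_I, map_ofNat]
  have := Complex.I_ne_zero
  have : (Real.pi : ℂ) ≠ 0 := by exact_mod_cast Real.pi_ne_zero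
  field_simp
  ring

theorem deBrangesKernel_eq_zero {E : ℂ → ℂ} {l : ℝ} (h : E l = 0) : deBrangesKernel E l = 0 := by
  ext z
  have : kernelNumerator E l = fun _ => 0 := by
    ext z; simp [kernelNumerator, h]
  rw [deBrangesKernel_eq_dslope, this]
  by_cases hz : z = conj (l : ℂ)
  · rw [hz, dslope_same]; simp
  · rw [dslope_of_ne _ hz, slope_def_module]; simp

/-- The function is unbounded near `l`, but it is the quotient of the bounded functions 1 / (z + I)
and (z - l) / (z + I). -/
theorem isTame_inv_sub_real (l : ℝ) : IsTame fun z => 1 / (z - l) := by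
  have hne : ∀ z : ℂ, 0 < z.im → z - l ≠ 0 := fun z hz h => by
    have := congrArg Complex.im h
    simp at this
    exact hz.ne' this
  have hI : ∀ z : ℂ, 0 < z.im → 1 ≤ ‖z + Complex.I‖ := fun z hz => by
    have := Complex.abs_im_le_norm (z + Complex.I)
    simp only [Complex.add_im, Complex.I_im] at this
    have := le_abs_self (z.im + 1)
    linarith
  refine ⟨⟨?_, fun z => 1 / (z + Complex.I), fun z => (z - l) / (z + Complex.I), ?_, ?_,
    ⟨1 + ‖Complex.I + l‖, fun z hz => ⟨?_, ?_⟩⟩, ⟨Complex.I, by simp, ?_⟩, fun z hz => ?_⟩,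
    meanType_nonpos_of_bounded (M := 1) ?_⟩
  · exact DifferentiableOn.div (by fun_prop) (by fun_prop) hne
  · exact DifferentiableOn.div (by fun_prop) (by fun_prop) fun z hz =>
      add_I_ne_zero (le_of_lt hz)
  · exact DifferentiableOn.div (by fun_prop) (by fun_prop) fun z hz =>
      add_I_ne_zero (le_of_lt hz)
  · rw [norm_div, norm_one]
    have := div_le_one_of_le₀ (hI z hz) (norm_nonneg _)
    have := norm_nonneg (Complex.I + l)
    linarith
  · have h1 : (z - l) / (z + Complex.I) = 1 - (Complex.I + l) / (z + Complex.I) := by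
      have := add_I_ne_zero hz.le
      field_simp; ring
    change ‖(z - l) / (z + Complex.I)‖ ≤ _
    rw [h1]
    refine (norm_sub_le _ _).trans ?_
    rw [norm_one, norm_div]
    gcongr
    exact div_le_self (norm_nonneg _) (hI z hz)
  · exact div_ne_zero (hne _ (by simp)) (add_I_ne_zero (by simp))
  · have := hne z hz
    have := add_I_ne_zero hz.le
    field_simp
  · filter_upwards [eventually_ge_atTop 1] with y hy
    rw [norm_div, norm_one]
    refine div_le_one_of_le₀ ?_ (norm_nonneg _)
    have := Complex.abs_im_le_norm ((y : ℂ) * Complex.I - l)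
    simp only [Complex.sub_im, Complex.mul_im, Complex.ofReal_re, Complex.I_im, Complex.ofReal_im,
      Complex.I_re, mul_one, mul_zero, add_zero, sub_zero] at this
    have := le_abs_self y
    linarith

namespace IsHermiteBiehler

variable {E : ℂ → ℂ}

/-- The kernel functions with real parameter belong to the de Branges space. -/
theorem deBrangesKernel_mem (hE : IsHermiteBiehler E) (l : ℝ) :
    deBrangesKernel E l ∈ deBrangesSpace E := by
  by_cases hl : E l = 0
  · rw [deBrangesKernel_eq_zero hl]
    exact (deBrangesSubmodule hE).zero_mem
  have hπ := Real.pi_pos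
  have hd := hE.entire.deBrangesKernel l
  have htame : IsTame fun z => deBrangesKernel E l z / E z := by
    have h1 : IsTame fun z => conj (E l) + -(E l) * (entireStar E z / E z) :=
      (IsTame.const _).add ((IsTame.const _).mul hE.isTame_star_div)
    refine ((h1.mul (isTame_inv_sub_real l)).mul
      (IsTame.const (-(2 * Real.pi * Complex.I)⁻¹))).congr fun z hz => ?_
    have hzl : z ≠ l := fun h => by rw [h] at hz; simp at hz
    have h2 : (l : ℂ) - z = -(z - l) := by ring
    have h3 : z - l ≠ 0 := sub_ne_zero.2 hzl
    have h4 := hE.ne_zero hz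
    have := Complex.I_ne_zero
    have : (Real.pi : ℂ) ≠ 0 := by exact_mod_cast Real.pi_ne_zero
    rw [deBrangesKernel_of_ne hzl, h2]
    field_simp
    ring
  refine ⟨hd, ?_, htame, by rwa [entireStar_deBrangesKernel hE.entire]⟩
  -- square-integrability
  have hcont : ContinuousAt (fun t : ℝ => deBrangesKernel E l t / E t) l := by
    refine ContinuousAt.div ?_ ?_ hl
    · exact (hd.continuous.comp Complex.continuous_ofReal).continuousAt
    · exact (hE.entire.continuous.comp Complex.continuous_ofReal).continuousAt
  obtain ⟨M, hM⟩ : ∃ M, ∀ᶠ t in 𝓝 l, ‖deBrangesKernel E l (t : ℝ) / E t‖ ≤ M :=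
    ⟨_, hcont.norm.eventually_le_const (lt_add_one _)⟩
  obtain ⟨δ, hδ, hball⟩ := Metric.eventually_nhds_iff.1 hM
  -- Near `l` the quotient is bounded by continuity, as E(l) ≠ 0. Elsewhere |E*(t)| = |E(t)| bounds
  -- it by c / |t - l|. Both bounds fit under a multiple of 1 / (1 + (t - l)²).
  set c := ‖E l‖ / Real.pi with hc
  have hfar : ∀ᵐ t : ℝ, ‖deBrangesKernel E l (t : ℝ) / E t‖ ^ 2 ≤
      (M ^ 2 * (1 + δ ^ 2) + c ^ 2 * (1 + 1 / δ ^ 2)) * (1 + (t - l) ^ 2)⁻¹ := by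
    filter_upwards [hE.ae_ne_zero, ae_ne_ofReal (l : ℂ)] with t ht htl
    have hp : 0 < 1 + (t - l) ^ 2 := by positivity
    rw [← div_eq_mul_inv, le_div_iff₀ hp]
    by_cases hdist : dist t l < δ
    · have h1 := hball hdist
      have h2 : (t - l) ^ 2 ≤ δ ^ 2 := by
        rw [Real.dist_eq] at hdist
        rw [← sq_abs]
        gcongr
      have h3 : ‖deBrangesKernel E l (t : ℝ) / E t‖ ^ 2 ≤ M ^ 2 := by gcongr
      calc _ ≤ M ^ 2 * (1 + δ ^ 2) := by gcongr
        _ ≤ _ := le_add_of_nonneg_right (by positivity)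
    · rw [not_lt, Real.dist_eq] at hdist
      have hs : 0 < |t - l| := hδ.trans_le hdist
      have h1 : ‖deBrangesKernel E l (t : ℝ) / E t‖ ≤ c / |t - l| := by
        rw [deBrangesKernel_of_ne htl, entireStar_ofReal, norm_div, norm_div]
        have h2 : ‖conj (E l) * E t - E l * conj (E t)‖ ≤ 2 * ‖E l‖ * ‖E t‖ := by
          refine (norm_sub_le _ _).trans (le_of_eq ?_)
          rw [norm_mul, norm_mul, RCLike.norm_conj, RCLike.norm_conj]; ring
        have h3 : ‖2 * (Real.pi : ℂ) * Complex.I * (l - t)‖ = 2 * Real.pi * |t - l| := by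
          rw [norm_mul, norm_mul, norm_mul, ← Complex.ofReal_sub, Complex.norm_real,
            Complex.norm_real, Real.norm_of_nonneg hπ.le, Real.norm_eq_abs, abs_sub_comm]
          simp
        have h4 : 0 < ‖E t‖ := norm_pos_iff.2 ht
        rw [h3, div_div, div_le_iff₀ (mul_pos (mul_pos (by positivity) hs) h4), hc]
        refine h2.trans (le_of_eq ?_)
        field_simp
      have h5 : ‖deBrangesKernel E l (t : ℝ) / E t‖ ^ 2 ≤ c ^ 2 / (t - l) ^ 2 := by
        rw [← sq_abs (t - l), ← div_pow]
        gcongr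
      have h6 : δ ^ 2 ≤ (t - l) ^ 2 := by
        rw [← sq_abs (t - l)]; gcongr
      have h7 : 0 < (t - l) ^ 2 := (by positivity : 0 < δ ^ 2).trans_le h6
      calc _ ≤ c ^ 2 / (t - l) ^ 2 * (1 + (t - l) ^ 2) := by gcongr
        _ = c ^ 2 * (1 + 1 / (t - l) ^ 2) := by
          have := h7.ne'
          generalize (t - l) ^ 2 = x at this ⊢
          field_simp
          ring
        _ ≤ c ^ 2 * (1 + 1 / δ ^ 2) := by gcongr
        _ ≤ _ := le_add_of_nonneg_left (by positivity)
  refine lt_of_le_of_lt ?_ (lintegral_inv_one_add_sq_lt_top l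
    (M ^ 2 * (1 + δ ^ 2) + c ^ 2 * (1 + 1 / δ ^ 2)))
  refine lintegral_mono_ae ?_
  filter_upwards [hfar] with t ht
  rw [← ofReal_norm, ← ENNReal.ofReal_pow (norm_nonneg _)]
  exact ENNReal.ofReal_le_ofReal ht

/-- The kernel function as an element of the de Branges space. -/
def kernelElem (hE : IsHermiteBiehler E) (l : ℝ) : deBrangesSubmodule hE :=
  ⟨deBrangesKernel E l, hE.deBrangesKernel_mem l⟩

/-- The reproducing property at a real point. -/
theorem inner_kernelElem (hE : IsHermiteBiehler E) (l : ℝ) (h : deBrangesSubmodule hE) :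
    inner ℂ (hE.toL2 (hE.kernelElem l)) (hE.toL2 h) = h.1 l := by
  obtain ⟨u, hu, huE⟩ := hE.exists_isHardy h.2
  obtain ⟨v, hv, hvE⟩ := hE.exists_isHardy (entireStar_mem_deBrangesSpace h.2)
  by_cases hl : E l = 0
  · have h0 : hE.kernelElem l = 0 := Subtype.ext (deBrangesKernel_eq_zero hl)
    -- Both sides vanish: h = uE with `u` analytic at `l`, so h inherits the zero of `E`.
    rw [h0, map_zero, inner_zero_left, ← huE l (by simp), hl, mul_zero]
  have hπ : (Real.pi : ℂ) ≠ 0 := by exact_mod_cast Real.pi_ne_zero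
  have hI := Complex.I_ne_zero
  -- With h = uE and h* = vE the integrand is (E(l) u - conj(E(l)) conj(v)) / (2πi (t - l)), whose
  -- two halves are separately singular at `l`. Comparison functions with pole l - I make each half
  -- integrable with integral zero. What was subtracted adds up to h(l) / (π((t - l)² + 1)), of
  -- total mass h(l).
  obtain ⟨h1, h2⟩ := hu.integral_sub_div (z₀ := l) (a := l - Complex.I) (by simp) (by simp)
  obtain ⟨h3, h4⟩ := hv.integral_sub_div (z₀ := l) (a := l - Complex.I) (by simp) (by simp)
  set A : ℝ → ℂ := fun t => (u t - u l * (l - (l - Complex.I)) / (t - (l - Complex.I))) / (t - l)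
    with hA
  set B : ℝ → ℂ := fun t => (v t - v l * (l - (l - Complex.I)) / (t - (l - Complex.I))) / (t - l)
    with hB
  have h3' : Integrable fun t => conj (B t) := (Complex.conjCLE : ℂ ≃L[ℝ] ℂ).integrable_comp_iff.2 h3
  have h4' : ∫ t, conj (B t) = 0 := by rw [integral_conj, h4, map_zero]
  have hzim : 0 < ((l : ℂ) + Complex.I).im := by simp
  obtain ⟨h5, h6⟩ := integral_inv_norm_sub_sq hzim
  have hul : u l * E l = h.1 l := huE l (by simp)
  have hvl : conj (v l) * conj (E l) = h.1 l := by
    rw [← map_mul, hvE l (by simp), entireStar_ofReal, Complex.conj_conj]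
  have hnorm : ∀ t : ℝ, ((1 / ‖(t : ℂ) - (l + Complex.I)‖ ^ 2 : ℝ) : ℂ) =
      1 / (((t : ℂ) - (l - Complex.I)) * (t - (l + Complex.I))) := by
    intro t
    have : (t : ℂ) - (l - Complex.I) = conj ((t : ℂ) - (l + Complex.I)) := by simp; ring
    rw [this, ← Complex.normSq_eq_conj_mul_self, Complex.normSq_eq_norm_sq]
    push_cast
    rfl
  have hdec : (fun t : ℝ => conj (deBrangesKernel E l t / E t) * (h.1 t / E t)) =ᵐ[volume]
      fun t => (2 * Real.pi * Complex.I)⁻¹ * (E l * A t) +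
        (-(2 * Real.pi * Complex.I)⁻¹ * conj (E l) * conj (B t) +
        h.1 l / Real.pi * ((1 / ‖(t : ℂ) - (l + Complex.I)‖ ^ 2 : ℝ) : ℂ)) := by
    filter_upwards [hE.ae_ne_zero, ae_ne_ofReal (l : ℂ)] with t ht htl
    have hut : u t = h.1 t / E t := eq_div_of_mul_eq ht (huE t (by simp))
    have hEt : conj (E t) ≠ 0 := (map_ne_zero _).2 ht
    have hvt : conj (v t) = h.1 t / conj (E t) := by
      refine eq_div_of_mul_eq hEt ?_
      rw [← map_mul, hvE t (by simp), entireStar_ofReal, Complex.conj_conj]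
    have htl' : (t : ℂ) - l ≠ 0 := sub_ne_zero.2 htl
    have hlt : (l : ℂ) - t = -(t - l) := by ring
    have hne1 : (t : ℂ) - (l - Complex.I) ≠ 0 := fun h => by
      have := congrArg Complex.im h; simp at this
    have hne2 : (t : ℂ) - (l + Complex.I) ≠ 0 := fun h => by
      have := congrArg Complex.im h; simp at this
    have hu' : u l = h.1 l / E l := eq_div_of_mul_eq hl hul
    have hv' : conj (v l) = h.1 l / conj (E l) := eq_div_of_mul_eq ((map_ne_zero _).2 hl) hvl
    have hEl : conj (E l) ≠ 0 := (map_ne_zero _).2 hl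
    have hBt : conj (B t) = (conj (v t) - conj (v l) * (-Complex.I) / (t - (l + Complex.I))) /
        (t - l) := by
      simp only [hB, map_div₀, map_sub, map_mul, Complex.conj_ofReal, Complex.conj_I]
      congr 3 <;> ring
    rw [hnorm, hBt, deBrangesKernel_of_ne htl, entireStar_ofReal]
    simp only [hA, map_div₀, map_sub, map_mul, Complex.conj_ofReal, Complex.conj_I,
      Complex.conj_conj, map_ofNat]
    rw [hvt, hut, hu', hv', hlt]
    field_simp
    ring
  rw [hE.inner_toL2]
  change ∫ t : ℝ, conj (deBrangesKernel E l t / E t) * (h.1 t / E t) = h.1 l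
  have i1 : Integrable fun t => (2 * Real.pi * Complex.I)⁻¹ * (E l * A t) :=
    (h1.const_mul _).const_mul _
  have i2 : Integrable fun t => -(2 * Real.pi * Complex.I)⁻¹ * conj (E l) * conj (B t) :=
    h3'.const_mul _
  have i3 : Integrable fun t : ℝ =>
      h.1 l / Real.pi * ((1 / ‖(t : ℂ) - (l + Complex.I)‖ ^ 2 : ℝ) : ℂ) := h5.ofReal.const_mul _
  have i23 : Integrable fun t : ℝ =>
      -(2 * Real.pi * Complex.I)⁻¹ * conj (E l) * conj (B t) +
        h.1 l / Real.pi * ((1 / ‖(t : ℂ) - (l + Complex.I)‖ ^ 2 : ℝ) : ℂ) := i2.add i3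
  rw [integral_congr_ae hdec, integral_add i1 i23, integral_add i2 i3, integral_const_mul,
    integral_const_mul, integral_const_mul,
    integral_const_mul, h2, h4', integral_complex_ofReal, h6]
  simp

/-- Cauchy's formula writes the value of f / E at z as an inner product with a fixed L² function;
then Cauchy-Schwarz. -/
theorem exists_norm_le_of_im_pos (hE : IsHermiteBiehler E) {z : ℂ} (hz : 0 < z.im) :
    ∃ C : ℝ, ∀ f : deBrangesSubmodule hE, ‖f.1 z‖ ≤ C * ‖hE.toL2 f‖ := by
  have hk : MemLp (fun t : ℝ => conj (1 / ((t : ℂ) - z))) 2 := (memLp_inv_sub hz).star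
  refine ⟨(2 * Real.pi)⁻¹ * ‖hk.toLp _‖ * ‖E z‖, fun f => ?_⟩
  obtain ⟨u, hu, huE⟩ := hE.exists_isHardy f.2
  have h1 : inner ℂ (hk.toLp _) (hE.toL2 f) = 2 * Real.pi * Complex.I * u z := by
    rw [← hu.integral_div_sub hz, L2.inner_def]
    refine integral_congr_ae ?_
    filter_upwards [hk.coeFn_toLp, hE.coeFn_toL2 f, hE.ae_ne_zero] with t h1 h2 h3
    rw [h1, h2, RCLike.inner_apply, Complex.conj_conj, ← huE t (by simp),
      mul_div_cancel_right₀ _ h3]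
  have h2 := norm_inner_le_norm (𝕜 := ℂ) (hk.toLp _) (hE.toL2 f)
  rw [h1] at h2
  simp only [norm_mul, Complex.norm_I, Complex.norm_real, Real.norm_of_nonneg Real.pi_pos.le,
    Complex.norm_two, mul_one] at h2
  rw [← huE z hz.le, norm_mul]
  have hπ := Real.pi_pos
  have h3 : ‖u z‖ ≤ (2 * Real.pi)⁻¹ * (‖hk.toLp _‖ * ‖hE.toL2 f‖) := by
    rw [← div_eq_inv_mul, le_div_iff₀ (by positivity)]
    linarith
  calc ‖u z‖ * ‖E z‖ ≤ (2 * Real.pi)⁻¹ * (‖hk.toLp _‖ * ‖hE.toL2 f‖) * ‖E z‖ := by gcongr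
    _ = _ := by ring

/-- Point evaluations are bounded. -/
theorem exists_norm_le (hE : IsHermiteBiehler E) (z : ℂ) :
    ∃ C : ℝ, ∀ f : deBrangesSubmodule hE, ‖f.1 z‖ ≤ C * ‖hE.toL2 f‖ := by
  rcases lt_trichotomy z.im 0 with hz | hz | hz
  · obtain ⟨C, hC⟩ := hE.exists_norm_le_of_im_pos (z := conj z) (by simpa using hz)
    refine ⟨C, fun f => ?_⟩
    set g : deBrangesSubmodule hE := ⟨entireStar f.1, entireStar_mem_deBrangesSpace f.2⟩ with hg
    have h1 := hC g
    have h2 : ‖hE.toL2 g‖ = ‖hE.toL2 f‖ := by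
      have h3 := hE.deBrangesNormSq_eq g
      rw [show g.1 = entireStar f.1 from rfl, deBrangesNormSq_entireStar,
        hE.deBrangesNormSq_eq f] at h3
      have h4 := (ENNReal.pow_right_strictMono two_ne_zero).injective h3
      rw [← toReal_enorm, ← toReal_enorm, h4]
    rw [h2] at h1
    simpa [hg, entireStar] using h1
  · have hzz : z = (z.re : ℂ) := Complex.ext rfl (by simpa using hz)
    refine ⟨‖hE.toL2 (hE.kernelElem z.re)‖, fun f => ?_⟩
    rw [hzz, Complex.ofReal_re, ← hE.inner_kernelElem]
    exact norm_inner_le_norm _ _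
  · exact hE.exists_norm_le_of_im_pos hz

end IsHermiteBiehler

/-! ### Orthogonal expansions and the multiplexing isometry -/

/-- Orthogonal expansions converge for vectors in the closed span of an orthogonal family. The
family may contain zero vectors. -/
theorem tendsto_sub_sum_of_orthogonal {ι H : Type*} [NormedAddCommGroup H]
    [InnerProductSpace ℂ H] {e : ι → H} (he : Pairwise fun m n => inner ℂ (e m) (e n) = 0) {x : H}
    (hx : ∀ ε > 0, ∃ c : ι →₀ ℂ, ‖x - c.sum fun n a => a • e n‖ < ε) :
    Tendsto (fun s : Finset ι => ‖x - ∑ n ∈ s, (inner ℂ (e n) x / inner ℂ (e n) (e n)) • e n‖)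
      atTop (𝓝 0) := by
  refine Metric.tendsto_nhds.2 fun ε hε => ?_
  obtain ⟨c, hc⟩ := hx ε hε
  filter_upwards [eventually_ge_atTop c.support] with s hs
  set S := ∑ n ∈ s, (inner ℂ (e n) x / inner ℂ (e n) (e n)) • e n with hS
  -- When `e n` is zero its coefficient is 0 / 0 = 0, and orthogonality is trivial.
  have horth : ∀ n ∈ s, inner ℂ (x - S) (e n) = 0 := by
    intro n hn
    rw [← inner_conj_symm, inner_sub_right, hS, inner_sum, Finset.sum_eq_single_of_mem n hn
      fun m _ hmn => by rw [inner_smul_right, he hmn.symm, mul_zero], inner_smul_right]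
    by_cases h0 : e n = 0
    · simp [h0]
    · rw [div_mul_cancel₀ _ (inner_self_ne_zero.2 h0), sub_self, map_zero]
  set p := c.sum fun n a => a • e n with hp
  have h1 : inner ℂ (x - S) p = 0 := by
    rw [hp, Finsupp.sum, inner_sum]
    exact Finset.sum_eq_zero fun n hn => by rw [inner_smul_right, horth n (hs hn), mul_zero]
  have h2 : inner ℂ (x - S) S = 0 := by
    conv_lhs => rw [hS, inner_sum]
    exact Finset.sum_eq_zero fun n hn => by rw [inner_smul_right, ← hS, horth n hn, mul_zero]
  -- `S` is the best approximation from the span of the `e n` with `n ∈ s`, which contains `p`; this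
  -- gives convergence along all finite sets, without completeness of the space.
  have h3 : ‖x - S‖ * ‖x - S‖ ≤ ‖x - S‖ * ‖x - p‖ := by
    have h4 : inner ℂ (x - S) (x - S) = inner ℂ (x - S) (x - p) := by
      rw [inner_sub_right _ x S, inner_sub_right _ x p, h1, h2]
    rw [← inner_self_eq_norm_mul_norm (𝕜 := ℂ), h4]
    exact re_inner_le_norm _ _
  rw [dist_zero_right, norm_norm]
  refine lt_of_le_of_lt ?_ hc
  rcases (norm_nonneg (x - S)).eq_or_lt' with h | h
  · rw [h]; exact norm_nonneg _
  · exact le_of_mul_le_mul_left h3 h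

/-- The reproducing kernel of a product at a real point. -/
theorem deBrangesKernel_mul {E F : ℂ → ℂ} (hE : Differentiable ℂ E) (hF : Differentiable ℂ F)
    (l : ℝ) (z : ℂ) : deBrangesKernel (E * F) l z =
      multiplexedSample E F (fun z => conj (F l) * deBrangesKernel E l z)
        (fun z => E l * deBrangesKernel F l z) z := by
  have h := hE.mul hF |>.deBrangesKernel l
  have h1 := hE.deBrangesKernel l
  have h2 := hF.deBrangesKernel l
  have h3 := hE.entireStar
  refine congrFun (Continuous.ext_on (f := deBrangesKernel (E * F) l)
    (dense_compl_singleton (l : ℂ)) h.continuous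
    (Differentiable.continuous (𝕜 := ℂ) ?_) fun z hz => ?_) z
  · unfold multiplexedSample
    fun_prop
  · have hz : z ≠ l := hz
    have hlz : (l : ℂ) - z ≠ 0 := sub_ne_zero.2 hz.symm
    have hI := Complex.I_ne_zero
    have hπ : (Real.pi : ℂ) ≠ 0 := by exact_mod_cast Real.pi_ne_zero
    simp only [multiplexedSample]
    rw [deBrangesKernel_of_ne hz, deBrangesKernel_of_ne hz, deBrangesKernel_of_ne hz]
    simp only [Pi.mul_apply, entireStar, map_mul]
    -- Away from `l` the numerator telescopes after adding and subtracting conj(F(l)) F(z) E(l)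
    -- E*(z).
    field_simp
    ring

/-- Kernels at two points where the phase agrees modulo `π` are orthogonal. -/
theorem deBrangesKernel_eq_zero_of_phase {E : ℂ → ℂ} {φ : ℝ → ℝ} (hφ : IsPhaseFunction E φ)
    {x y α : ℝ} {m n : ℤ} (hx : φ x = m * Real.pi + α) (hy : φ y = n * Real.pi + α) (hxy : x ≠ y) :
    deBrangesKernel E x y = 0 := by
  -- Reality of E e^{iφ} means conj E = E e^{2iφ}, and e^{2iφ} = e^{2iα} at all points considered.
  -- So the ratio conj E / E is common to them and the numerator of the kernel cancels.
  have key : ∀ {x : ℝ} {m : ℤ}, φ x = m * Real.pi + α →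
      conj (E x) = E x * Complex.exp (Complex.I * α) ^ 2 := by
    intro x m hx
    have h1 := Complex.conj_eq_iff_im.2 (hφ.real x)
    have h2 : Complex.exp (Complex.I * φ x) ^ 2 = Complex.exp (Complex.I * α) ^ 2 := by
      rw [← Complex.exp_nat_mul, ← Complex.exp_nat_mul, Complex.exp_eq_exp_iff_exists_int]
      refine ⟨m, ?_⟩
      rw [hx]
      push_cast
      ring
    have h3 : conj (Complex.exp (Complex.I * φ x)) * Complex.exp (Complex.I * φ x) = 1 := by
      rw [← Complex.exp_conj, ← Complex.exp_add]
      simp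
    rw [← h2]
    rw [map_mul] at h1
    linear_combination Complex.exp (Complex.I * φ x) * h1 - conj (E x) * h3
  have hne : (y : ℂ) ≠ x := by exact_mod_cast hxy.symm
  rw [deBrangesKernel_of_ne hne, entireStar_ofReal, key hx, key hy]
  rw [div_eq_zero_iff]
  left
  ring

namespace IsHermiteBiehler

variable {E F : ℂ → ℂ}

theorem memLp_star_div_mul (hE : IsHermiteBiehler E) {u : ℝ → ℂ} (hu : MemLp u 2) :
    MemLp (fun t : ℝ => u t * (entireStar E t / E t)) 2 := by
  refine hu.of_le (hu.1.mul (hE.aestronglyMeasurable_div hE.entire.entireStar))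
    (ae_of_all _ fun t => ?_)
  rw [norm_mul, norm_div, entireStar_ofReal, RCLike.norm_conj]
  exact mul_le_of_le_one_right (norm_nonneg _) (div_self_le_one _)

/-- The multiplexing map sends `H(E) × H(F)` to `H(EF)`. -/
theorem multiplexedSample_mem (hE : IsHermiteBiehler E) (hF : IsHermiteBiehler F) {f g : ℂ → ℂ}
    (hf : f ∈ deBrangesSpace E) (hg : g ∈ deBrangesSpace F) :
    multiplexedSample E F f g ∈ deBrangesSpace (E * F) := by
  obtain ⟨hfd, hfn, hf1, hf2⟩ := hf
  obtain ⟨hgd, hgn, hg1, hg2⟩ := hg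
  have hstar := hE.entire.entireStar
  have hFd := hF.entire
  refine ⟨?_, ?_, ?_, ?_⟩
  · unfold multiplexedSample
    fun_prop
  · have h := (hE.memLp_div hfd hfn).add (hE.memLp_star_div_mul (hF.memLp_div hgd hgn))
    have h2 := ((memLp_two_iff_integrable_sq_norm h.1).1 h).2
    rw [HasFiniteIntegral] at h2
    simp only [enorm_pow, enorm_norm] at h2
    refine lt_of_eq_of_lt (lintegral_congr_ae ?_) h2
    filter_upwards [hE.ae_ne_zero, hF.ae_ne_zero] with t h1 h2
    simp only [multiplexedSample, Pi.add_apply, Pi.mul_apply]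
    congr 2
    field_simp
  · refine (IsTame.add hf1 (IsTame.mul hg1 hE.isTame_star_div)).congr fun z hz => ?_
    have h1 := hE.ne_zero hz
    have h2 := hF.ne_zero hz
    simp only [multiplexedSample, Pi.mul_apply]
    field_simp
  -- The involution exchanges the roles: (fF + gE*)* / (EF) = (f*/E)(F*/F) + g*/F.
  · refine (IsTame.add (IsTame.mul hf2 hF.isTame_star_div) hg2).congr fun z hz => ?_
    have h1 := hE.ne_zero hz
    have h2 := hF.ne_zero hz
    simp only [multiplexedSample, entireStar, Pi.mul_apply, map_add, map_mul, Complex.conj_conj]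
    field_simp

/-- The multiplexing map `(f, g) ↦ f F + g E*`. -/
def multiplex (hE : IsHermiteBiehler E) (hF : IsHermiteBiehler F)
    (f : deBrangesSubmodule hE) (g : deBrangesSubmodule hF) : deBrangesSubmodule (hE.mul hF) :=
  ⟨multiplexedSample E F f.1 g.1, hE.multiplexedSample_mem hF f.2 g.2⟩

/-- The multiplexing map is isometric. -/
theorem norm_multiplex_sq (hE : IsHermiteBiehler E) (hF : IsHermiteBiehler F)
    (f : deBrangesSubmodule hE) (g : deBrangesSubmodule hF) :
    ‖(hE.mul hF).toL2 (hE.multiplex hF f g)‖ ^ 2 = ‖hE.toL2 f‖ ^ 2 + ‖hF.toL2 g‖ ^ 2 := by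
  have hg := hF.memLp_div g.2.1 g.2.2.1
  have hb := hE.memLp_star_div_mul hg
  have hsum : (hE.mul hF).toL2 (hE.multiplex hF f g) = hE.toL2 f + hb.toLp _ := by
    refine Lp.ext ?_
    filter_upwards [(hE.mul hF).coeFn_toL2 (hE.multiplex hF f g), hE.coeFn_toL2 f, hb.coeFn_toLp,
      Lp.coeFn_add (hE.toL2 f) (hb.toLp _), hE.ae_ne_zero, hF.ae_ne_zero] with t h1 h2 h3 h4 h5 h6
    rw [h1, h4, Pi.add_apply, h2, h3]
    simp only [multiplex, multiplexedSample, Pi.mul_apply]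
    field_simp
  have hnorm : ‖hb.toLp _‖ = ‖hF.toL2 g‖ := by
    rw [Lp.norm_def, Lp.norm_def, eLpNorm_congr_ae hb.coeFn_toLp,
      eLpNorm_congr_ae (hF.coeFn_toL2 g)]
    congr 1
    refine eLpNorm_congr_norm_ae ?_
    filter_upwards [hE.ae_ne_zero] with t ht
    rw [norm_mul, norm_div (entireStar E t), entireStar_ofReal, RCLike.norm_conj,
      div_self (norm_ne_zero_iff.2 ht), mul_one]
  obtain ⟨v, hv, hvE⟩ := hE.exists_isHardy (entireStar_mem_deBrangesSpace f.2)
  obtain ⟨w, hw, hwF⟩ := hF.exists_isHardy g.2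
  -- On the real line conj(f/E) · E*/E = f*/E, so the inner product is the integral of the Hardy
  -- function (f*/E)(g/F).
  have hinner : inner ℂ (hE.toL2 f) (hb.toLp _) = 0 := by
    rw [← (hv.mul hw).integral_eq_zero, L2.inner_def]
    refine integral_congr_ae ?_
    filter_upwards [hE.coeFn_toL2 f, hb.coeFn_toLp, hE.ae_ne_zero, hF.ae_ne_zero]
      with t h1 h2 h3 h4
    have h5 : conj (E t) ≠ 0 := (map_ne_zero _).2 h3
    have h6 := hvE t (by simp)
    rw [entireStar_ofReal] at h6
    rw [h1, h2, RCLike.inner_apply, map_div₀, ← h6, ← hwF t (by simp), entireStar_ofReal]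
    field_simp
  have := norm_add_sq_eq_norm_sq_add_norm_sq_of_inner_eq_zero _ _ hinner
  rw [hsum, sq, this, hnorm, sq, sq]

theorem tendsto_deBrangesNormSq {ι : Type*} {l : Filter ι} (hE : IsHermiteBiehler E)
    {u : ι → deBrangesSubmodule hE} (hu : Tendsto (fun s => ‖hE.toL2 (u s)‖) l (𝓝 0)) :
    Tendsto (fun s => deBrangesNormSq E (u s).1) l (𝓝 0) := by
  simp only [hE.deBrangesNormSq_eq, ← ofReal_norm]
  have h1 := ENNReal.tendsto_ofReal hu
  have h2 := ENNReal.Tendsto.pow (n := 2) h1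
  simpa using h2

theorem tendsto_apply {ι : Type*} {l : Filter ι} (hE : IsHermiteBiehler E)
    {u : ι → deBrangesSubmodule hE} (hu : Tendsto (fun s => ‖hE.toL2 (u s)‖) l (𝓝 0)) (z : ℂ) :
    Tendsto (fun s => (u s).1 z) l (𝓝 0) := by
  obtain ⟨C, hC⟩ := hE.exists_norm_le z
  exact squeeze_zero_norm (fun s => hC (u s)) (by simpa using hu.const_mul C)

end IsHermiteBiehler

theorem IsCompleteIn.exists_finsupp {ι : Type*} {E : ℂ → ℂ} (hE : IsHermiteBiehler E)
    {lam : ι → ℝ} (hc : IsCompleteIn E fun n => deBrangesKernel E (lam n))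
    (h : deBrangesSubmodule hE) {ε : ℝ} (hε : 0 < ε) :
    ∃ c : ι →₀ ℂ, ‖hE.toL2 h - c.sum fun n a => a • hE.toL2 (hE.kernelElem (lam n))‖ < ε := by
  obtain ⟨p, hp, hlt⟩ := hc h.1 h.2 (ENNReal.ofReal ε ^ 2) (by positivity)
  obtain ⟨c, rfl⟩ := Finsupp.mem_span_range_iff_exists_finsupp.1 hp
  refine ⟨c, ?_⟩
  set q : deBrangesSubmodule hE := h - c.sum fun n a => a • hE.kernelElem (lam n) with hq
  have h1 : q.1 = h.1 - c.sum fun n a => a • deBrangesKernel E (lam n) := by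
    simp [hq, Finsupp.sum, IsHermiteBiehler.kernelElem]
  have h2 : hE.toL2 q =
      hE.toL2 h - c.sum fun n a => a • hE.toL2 (hE.kernelElem (lam n)) := by
    simp [hq, Finsupp.sum]
  rw [← h1, hE.deBrangesNormSq_eq] at hlt
  rw [← h2]
  have h3 := (ENNReal.pow_right_strictMono two_ne_zero).lt_iff_lt.1 hlt
  rwa [← ofReal_norm, ENNReal.ofReal_lt_ofReal_iff hε] at h3

end

/-! ### The multiplexed sampling expansion -/

theorem corollaryC
    (E F : ℂ → ℂ) (hE : IsHermiteBiehler E) (hF : IsHermiteBiehler F)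
    (φ : ℝ → ℝ) (hφ : IsPhaseFunction (E * F) φ)
    (α : ℝ) (hα : α ∈ Set.Ico 0 Real.pi)
    (I : Set ℤ) (lam : I → ℝ)
    (hlam : ∀ n : I, φ (lam n) = ((n : ℤ) : ℝ) * Real.pi + α)
    (hcomplete : IsCompleteIn (E * F) (fun n : I => deBrangesKernel (E * F) (lam n)))
    (f g : ℂ → ℂ) (hf : f ∈ deBrangesSpace E) (hg : g ∈ deBrangesSpace F) :
    -- reconstruction of `f`, pointwise and in the norm of `H(E)`
    ((∀ z : ℂ, HasSum (fun n : I => multiplexedSample E F f g (lam n) *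
        (conj (F (lam n)) * deBrangesKernel E (lam n) z /
          deBrangesKernel (E * F) (lam n) (lam n))) (f z)) ∧
      Tendsto (fun s : Finset I => deBrangesNormSq E (fun z => f z -
        ∑ n ∈ s, multiplexedSample E F f g (lam n) *
          (conj (F (lam n)) * deBrangesKernel E (lam n) z /
            deBrangesKernel (E * F) (lam n) (lam n)))) atTop (𝓝 0)) ∧
    -- reconstruction of `g`, pointwise and in the norm of `H(F)`
    ((∀ z : ℂ, HasSum (fun n : I => multiplexedSample E F f g (lam n) *
        (E (lam n) * deBrangesKernel F (lam n) z /
          deBrangesKernel (E * F) (lam n) (lam n))) (g z)) ∧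
      Tendsto (fun s : Finset I => deBrangesNormSq F (fun z => g z -
        ∑ n ∈ s, multiplexedSample E F f g (lam n) *
          (E (lam n) * deBrangesKernel F (lam n) z /
            deBrangesKernel (E * F) (lam n) (lam n)))) atTop (𝓝 0)) := by
  have hEF := hE.mul hF
  let f' : deBrangesSubmodule hE := ⟨f, hf⟩
  let g' : deBrangesSubmodule hF := ⟨g, hg⟩
  let K : I → ℂ := fun n => deBrangesKernel (E * F) (lam n) (lam n)
  let a : I → ℂ := fun n => multiplexedSample E F f g (lam n) / K n
  let e : I → Lp ℂ 2 (volume : Measure ℝ) := fun n => hEF.toL2 (hEF.kernelElem (lam n))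
  have hinner : ∀ n (h : deBrangesSubmodule hEF), inner ℂ (e n) (hEF.toL2 h) = h.1 (lam n) :=
    fun n h => hEF.inner_kernelElem (lam n) h
  have horth : Pairwise fun m n => inner ℂ (e m) (e n) = 0 := by
    intro m n hmn
    rw [hinner]
    refine deBrangesKernel_eq_zero_of_phase hφ (hlam n) (hlam m) fun h => hmn ?_
    have h1 := (hlam m).symm.trans ((congrArg φ h.symm).trans (hlam n))
    have h2 := mul_right_cancel₀ Real.pi_ne_zero (add_right_cancel h1)
    exact Subtype.ext (by exact_mod_cast h2)
  have hlim := tendsto_sub_sum_of_orthogonal horth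
    (x := hEF.toL2 (hE.multiplex hF f' g')) fun ε hε => hcomplete.exists_finsupp hEF _ hε
  let u : Finset I → deBrangesSubmodule hE := fun s =>
    f' - ∑ n ∈ s, (a n * conj (F (lam n))) • hE.kernelElem (lam n)
  let v : Finset I → deBrangesSubmodule hF := fun s =>
    g' - ∑ n ∈ s, (a n * E (lam n)) • hF.kernelElem (lam n)
  have hu : ∀ s z, (u s).1 z = f z - ∑ n ∈ s, multiplexedSample E F f g (lam n) *
      (conj (F (lam n)) * deBrangesKernel E (lam n) z / K n) := by
    intro s z
    simp only [u, f', a, IsHermiteBiehler.kernelElem, AddSubgroupClass.coe_sub,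
      AddSubmonoidClass.coe_finsetSum, SetLike.val_smul, Pi.sub_apply, Finset.sum_apply,
      Pi.smul_apply, smul_eq_mul]
    congr 1
    exact Finset.sum_congr rfl fun n _ => by ring
  have hv : ∀ s z, (v s).1 z = g z - ∑ n ∈ s, multiplexedSample E F f g (lam n) *
      (E (lam n) * deBrangesKernel F (lam n) z / K n) := by
    intro s z
    simp only [v, g', a, IsHermiteBiehler.kernelElem, AddSubgroupClass.coe_sub,
      AddSubmonoidClass.coe_finsetSum, SetLike.val_smul, Pi.sub_apply, Finset.sum_apply,
      Pi.smul_apply, smul_eq_mul]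
    congr 1
    exact Finset.sum_congr rfl fun n _ => by ring
  -- The two remainders, with common coefficients `a n`, are sent to a single remainder in H(EF) by
  -- the kernel identity for products.
  have hmux : ∀ s, hE.multiplex hF (u s) (v s) =
      hE.multiplex hF f' g' - ∑ n ∈ s, a n • hEF.kernelElem (lam n) := by
    intro s
    refine Subtype.ext (funext fun z => ?_)
    simp only [IsHermiteBiehler.multiplex, IsHermiteBiehler.kernelElem,
      AddSubgroupClass.coe_sub, AddSubmonoidClass.coe_finsetSum, SetLike.val_smul, Pi.sub_apply,
      Finset.sum_apply, Pi.smul_apply, smul_eq_mul, deBrangesKernel_mul hE.entire hF.entire]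
    simp only [multiplexedSample, hu, hv, f', g']
    rw [sub_mul, sub_mul, Finset.sum_mul, Finset.sum_mul, sub_add_sub_comm,
      ← Finset.sum_add_distrib]
    congr 1
    refine Finset.sum_congr rfl fun n _ => ?_
    simp only [a, multiplexedSample]
    ring
  have hnorm : ∀ s, ‖hE.toL2 (u s)‖ ^ 2 + ‖hF.toL2 (v s)‖ ^ 2 =
      ‖hEF.toL2 (hE.multiplex hF f' g') - ∑ n ∈ s,
        (inner ℂ (e n) (hEF.toL2 (hE.multiplex hF f' g')) / inner ℂ (e n) (e n)) • e n‖ ^ 2 := by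
    intro s
    -- If EF vanishes at `lam n`, then `e n` and `K n` are zero and division by zero makes the term
    -- zero, as in the expansion lemma.
    have he : ∀ n, inner ℂ (e n) (e n) = K n := fun n => hinner n _
    rw [← hE.norm_multiplex_sq hF, hmux, map_sub, map_sum]
    simp only [map_smul, hinner, he]
    rfl
  have hul : Tendsto (fun s => ‖hE.toL2 (u s)‖) atTop (𝓝 0) :=
    squeeze_zero (fun _ => norm_nonneg _) (fun s => (pow_le_pow_iff_left₀ (norm_nonneg _)
      (norm_nonneg _) two_ne_zero).1 (by rw [← hnorm s]; exact le_add_of_nonneg_right (sq_nonneg _)))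
      hlim
  have hvl : Tendsto (fun s => ‖hF.toL2 (v s)‖) atTop (𝓝 0) :=
    squeeze_zero (fun _ => norm_nonneg _) (fun s => (pow_le_pow_iff_left₀ (norm_nonneg _)
      (norm_nonneg _) two_ne_zero).1 (by rw [← hnorm s]; exact le_add_of_nonneg_left (sq_nonneg _)))
      hlim
  refine ⟨⟨fun z => ?_, ?_⟩, ⟨fun z => ?_, ?_⟩⟩
  · have h := (hE.tendsto_apply hul z).const_sub (f z)
    simp only [hu, sub_sub_cancel, sub_zero] at h
    rwa [HasSum, SummationFilter.unconditional_filter]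
  · exact (hE.tendsto_deBrangesNormSq hul).congr fun s => congrArg _ (funext (hu s))
  · have h := (hF.tendsto_apply hvl z).const_sub (g z)
    simp only [hv, sub_sub_cancel, sub_zero] at h
    rwa [HasSum, SummationFilter.unconditional_filter]
  · exact (hF.tendsto_deBrangesNormSq hvl).congr fun s => congrArg _ (funext (hv s))
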